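/- Let $n\ge 2$, let $X$ be a compact Hausdorff space and let $\sigma=(\sigma_1,\dots,\sigma_n)$ be continuous maps $X\to X$ such that $X=\bigcup_{i=1}^n\sigma_i(X)$ (a surjective compact multivariable dynamical system). For a word $w=i_1\cdots i_k$ in $\{1,\dots,n\}$ put $|w|=k$ and $\sigma_w=\sigma_{i_1}\circ\cdots\circ\sigma_{i_k}$. The system is \emph{minimal} if for every $x\in X$ the orbit $\{\sigma_w(x): w \text{ a word}\}$ is dense in $X$. Let $\mathcal A_0$ be the algebra of polynomials $\sum_w \mathfrak s_w f_w$ in $\mathfrak s_1,\dots,\mathfrak s_n$ with coefficients $f_w\in C(X)$, multiplied according to $f\mathfrak s_i=\mathfrak s_i(f\circ\sigma_i)$. The tensor algebra $\mathcal A(X,\sigma)$ is the operator algebra obtained by completing $\mathcal A_0$ in the matrix norms given by the supremum over all representations $\rho$ on Hilbert space for which $\rho|_{C(X)}$ is a $*$-homomorphism and $\|[\rho(\mathfrak s_1)\ \cdots\ \rho(\mathfrak s_n)]\|\le 1$. Let $\mathfrak A=\mathrm C^*_{\mathrm e}(\mathcal A(X,\sigma))$ be its C*-envelope: a C*-algebra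 with a completely isometric homomorphism $j:\mathcal A(X,\sigma)\to\mathfrak A$ whose range generates $\mathfrak A$, such that for every completely isometric homomorphism $k$ of $\mathcal A(X,\sigma)$ into a C*-algebra generated by its range there is a surjective $*$-homomorphism $q:\mathrm C^*(k(\mathcal A(X,\sigma)))\to\mathfrak A$ with $qk=j$. Write $\mathfrak t_i=j(\mathfrak s_i)$ and $\mathfrak t_w=\mathfrak t_{i_1}\cdots\mathfrak t_{i_k}$. Let $\tilde X$ be the space of all pairs of sequences $(\mathbf i,\mathbf x)\in\{1,\dots,n\}^{\mathbb N}\times X^{\mathbb N}$ with $\sigma_{i_k}(x_{k+1})=x_k$ for all $k\ge0$, with the product topology; let $p(\mathbf i,\mathbf x)=x_0$ and $\tilde\sigma_i(\mathbf i,\mathbf x)=\big((i,i_0,i_1,\dots),(\sigma_i(x_0),x_0,x_1,\dots)\big)$. Then there is exactly one unital $*$-homomorphism $\pi:C(\tilde X)\to\mathfrak A$ with $\pi(f\circ p)=j(f)$ for $f\in C(X)$ and $\pi(g)\mathfrak t_i=\mathfrak t_i\,\pi(g\circ\tilde\sigma_i)$ for $g\in C(\tilde X)$, $1\le i\le n$;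 write $g$ for $\pi(g)$. Let \[ \mathfrak B=\overline{\operatorname{span}}\{\mathfrak t_u\, g\,\mathfrak t_v^*: |u|=|v|,\ g\in C(\tilde X)\}\subseteq\mathfrak A,\qquad \alpha(b)=VbV^*\ (b\in\mathfrak B),\qquad V=\tfrac1{\sqrt n}\sum_{i=1}^n\mathfrak t_i . \] A closed two-sided ideal $\mathfrak J$ of $\mathfrak B$ is \emph{$\alpha$-invariant} if $\alpha(\mathfrak J)\subseteq\mathfrak J$, and \emph{$\alpha$-bi-invariant} if in addition $b\in\mathfrak J$ whenever $b\in\mathfrak B$ and $\alpha(b)\in\mathfrak J$; it is \emph{proper} if $\mathfrak J\ne\{0\}$ and $\mathfrak J\ne\mathfrak B$. Then the following are equivalent: (1) $(X,\sigma)$ is minimal; (2) $\mathfrak B$ has no proper $\alpha$-invariant ideals; (3) $\mathfrak B$ has no proper $\alpha$-bi-invariant ideals. -/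

import Mathlib

universe u

noncomputable section

namespace MvDyn

/-! ### Multivariable dynamical systems

A compact multivariable dynamical system is a compact Hausdorff space `X` together with
continuous maps `σ 0, …, σ (n-1) : X → X` (properness is automatic on a compact Hausdorff space). -/

section Dynamics

variable {X : Type u} [TopologicalSpace X] {n : ℕ}

/-- `σ_w = σ_{i₁} ∘ ⋯ ∘ σ_{iₖ}` for the word `w = i₁ ⋯ iₖ`; the empty word gives the identity. -/
def wordMap (σ : Fin n → C(X, X)) : List (Fin n) → X → X
  | [], x => x
  | i :: w, x => σ i (wordMap σ w x)

/-- The system is surjective: `X` is the union of the ranges of the maps `σ i`. -/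
def IsSurjective (σ : Fin n → C(X, X)) : Prop :=
  (⋃ i, Set.range (σ i)) = Set.univ

/-- The orbit `{σ_w(x) : w a word}`. -/
def orbit (σ : Fin n → C(X, X)) (x : X) : Set X :=
  Set.range fun w : List (Fin n) => wordMap σ w x

/-- The system is minimal: every orbit is dense. -/
def IsMinimal (σ : Fin n → C(X, X)) : Prop :=
  ∀ x, Dense (orbit σ x)

/-! ### The covering system -/

/-- The covering space: all infinite tails `(i, x)`, that is, sequences `i` of indices and `x` of
points with `σ_{i_k}(x_{k+1}) = x_k` for all `k`, as a subspace of the product space. -/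
def Cover (σ : Fin n → C(X, X)) : Type u :=
  {z : (ℕ → Fin n) × (ℕ → X) // ∀ k, σ (z.1 k) (z.2 (k + 1)) = z.2 k}

instance (σ : Fin n → C(X, X)) : TopologicalSpace (Cover σ) :=
  inferInstanceAs (TopologicalSpace
    {z : (ℕ → Fin n) × (ℕ → X) // ∀ k, σ (z.1 k) (z.2 (k + 1)) = z.2 k})

/-- The projection `p (i, x) = x₀` of the covering space onto `X`. -/
def coverProj (σ : Fin n → C(X, X)) : C(Cover σ, X) where
  toFun z := z.1.2 0
  continuous_toFun :=
    (continuous_apply 0).comp (continuous_snd.comp continuous_subtype_val)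

/-- The sequence `(a, s₀, s₁, …)`. -/
def consSeq {A : Type*} (a : A) (s : ℕ → A) : ℕ → A
  | 0 => a
  | k + 1 => s k

/-- The maps `σ̃ᵢ ((i₀, i₁, …), (x₀, x₁, …)) = ((i, i₀, i₁, …), (σᵢ(x₀), x₀, x₁, …))` of the
covering system. -/
def coverMap (σ : Fin n → C(X, X)) (i : Fin n) : C(Cover σ, Cover σ) where
  toFun z := ⟨(consSeq i z.1.1, consSeq (σ i (z.1.2 0)) z.1.2), fun k => by
    cases k with
    | zero => rfl
    | succ k => exact z.2 k⟩
  continuous_toFun := by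
    have h1 : Continuous fun z : Cover σ => z.1.1 := continuous_fst.comp continuous_subtype_val
    have h2 : Continuous fun z : Cover σ => z.1.2 := continuous_snd.comp continuous_subtype_val
    refine Continuous.subtype_mk (Continuous.prodMk ?_ ?_) _
    · refine continuous_pi fun k => ?_
      cases k with
      | zero => exact continuous_const
      | succ k => exact (continuous_apply k).comp h1
    · refine continuous_pi fun k => ?_
      cases k with
      | zero => exact (σ i).continuous.comp ((continuous_apply 0).comp h2)
      | succ k => exact (continuous_apply k).comp h2

end Dynamics

/-! ### The covariance algebra and the tensor algebra norms -/

section TensorAlg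

variable {X : Type u} [TopologicalSpace X] {n : ℕ}

/-- The relations of the covariance algebra: the generators `f ∈ C(X)` form a copy of the unital
algebra `C(X)`, and `f sᵢ = sᵢ (f ∘ σᵢ)`. -/
inductive CovRel (σ : Fin n → C(X, X)) :
    FreeAlgebra ℂ (C(X, ℂ) ⊕ Fin n) → FreeAlgebra ℂ (C(X, ℂ) ⊕ Fin n) → Prop
  | scalar (c : ℂ) :
      CovRel σ (FreeAlgebra.ι ℂ (Sum.inl (algebraMap ℂ C(X, ℂ) c))) (algebraMap ℂ _ c)
  | add (f g : C(X, ℂ)) :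
      CovRel σ (FreeAlgebra.ι ℂ (Sum.inl (f + g)))
        (FreeAlgebra.ι ℂ (Sum.inl f) + FreeAlgebra.ι ℂ (Sum.inl g))
  | mul (f g : C(X, ℂ)) :
      CovRel σ (FreeAlgebra.ι ℂ (Sum.inl (f * g)))
        (FreeAlgebra.ι ℂ (Sum.inl f) * FreeAlgebra.ι ℂ (Sum.inl g))
  | cov (f : C(X, ℂ)) (i : Fin n) :
      CovRel σ (FreeAlgebra.ι ℂ (Sum.inl f) * FreeAlgebra.ι ℂ (Sum.inr i))
        (FreeAlgebra.ι ℂ (Sum.inr i) * FreeAlgebra.ι ℂ (Sum.inl (f.comp (σ i))))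

/-- The covariance algebra `𝒜₀(X, σ)`: polynomials `∑ s_w f_w` in `s₁, …, sₙ` with coefficients
in `C(X)`, multiplied according to `f sᵢ = sᵢ (f ∘ σᵢ)`. -/
abbrev CovAlg (σ : Fin n → C(X, X)) : Type u :=
  RingQuot (CovRel σ)

/-- The coefficient algebra `C(X)` inside the covariance algebra. -/
def coeff (σ : Fin n → C(X, X)) : C(X, ℂ) →ₐ[ℂ] CovAlg σ where
  toFun f := RingQuot.mkAlgHom ℂ (CovRel σ) (FreeAlgebra.ι ℂ (Sum.inl f))
  map_one' := by
    have h := RingQuot.mkAlgHom_rel ℂ (CovRel.scalar (σ := σ) 1)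
    simpa only [map_one] using h
  map_mul' f g := by
    rw [RingQuot.mkAlgHom_rel ℂ (CovRel.mul (σ := σ) f g), map_mul]
  map_zero' := by
    have h := RingQuot.mkAlgHom_rel ℂ (CovRel.scalar (σ := σ) 0)
    simpa only [map_zero] using h
  map_add' f g := by
    rw [RingQuot.mkAlgHom_rel ℂ (CovRel.add (σ := σ) f g), map_add]
  commutes' c := by
    rw [RingQuot.mkAlgHom_rel ℂ (CovRel.scalar (σ := σ) c), AlgHom.commutes]

/-- The generator `sᵢ` of the covariance algebra. -/
def gen (σ : Fin n → C(X, X)) (i : Fin n) : CovAlg σ :=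
  RingQuot.mkAlgHom ℂ (CovRel σ) (FreeAlgebra.ι ℂ (Sum.inr i))

theorem coeff_mul_gen (σ : Fin n → C(X, X)) (f : C(X, ℂ)) (i : Fin n) :
    coeff σ f * gen σ i = gen σ i * coeff σ (f.comp (σ i)) := by
  have h := RingQuot.mkAlgHom_rel ℂ (CovRel.cov (σ := σ) f i)
  rw [map_mul, map_mul] at h
  exact h

/-- Row contractive representations of the covariance algebra on a Hilbert space: the restriction
to `C(X)` is a `*`-homomorphism, and the row operator `[ρ(s₁) ⋯ ρ(sₙ)] : Hⁿ → H` is a contraction. -/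
def IsRowContractive (σ : Fin n → C(X, X)) {H : Type u} [NormedAddCommGroup H]
    [InnerProductSpace ℂ H] [CompleteSpace H] (ρ : CovAlg σ →ₐ[ℂ] (H →L[ℂ] H)) : Prop :=
  (∀ f : C(X, ℂ), ρ (coeff σ (star f)) = star (ρ (coeff σ f))) ∧
    ∀ h : Fin n → H, ‖∑ i, ρ (gen σ i) (h i)‖ ^ 2 ≤ ∑ i, ‖h i‖ ^ 2

/-- The norm of a matrix over the covariance algebra in the tensor algebra `𝒜(X, σ)`: the supremum
of its norms in all row contractive representations. The tensor algebra, as an operator algebra,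
is the completion of the covariance algebra in these matrix norms. -/
def tensorNorm (σ : Fin n → C(X, X)) {m : ℕ} (a : Matrix (Fin m) (Fin m) (CovAlg σ)) : ℝ :=
  sSup {r : ℝ | ∃ (H : Type u) (_ : NormedAddCommGroup H) (_ : InnerProductSpace ℂ H)
    (_ : CompleteSpace H) (ρ : CovAlg σ →ₐ[ℂ] (H →L[ℂ] H)),
      IsRowContractive σ ρ ∧ r = ‖CStarMatrix.ofMatrix (a.map ρ)‖}

/-- A homomorphism of the covariance algebra into a C*-algebra is completely isometric for the
tensor algebra norms (equivalently, it extends to a completely isometric homomorphism of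
`𝒜(X, σ)`). -/
def IsCompletelyIsometric (σ : Fin n → C(X, X)) {D : Type u} [CStarAlgebra D] [PartialOrder D]
    [StarOrderedRing D] (k : CovAlg σ →ₐ[ℂ] D) : Prop :=
  ∀ (m : ℕ) (a : Matrix (Fin m) (Fin m) (CovAlg σ)),
    ‖CStarMatrix.ofMatrix (a.map k)‖ = tensorNorm σ a

/-- A C*-cover of the tensor algebra: a completely isometric homomorphism whose range generates
the C*-algebra. -/
structure IsCStarCover (σ : Fin n → C(X, X)) {D : Type u} [CStarAlgebra D] [PartialOrder D]
    [StarOrderedRing D] (k : CovAlg σ →ₐ[ℂ] D) : Prop where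
  isometric : IsCompletelyIsometric σ k
  generates : (StarAlgebra.adjoin ℂ (Set.range k)).topologicalClosure = ⊤

/-- `j` exhibits `E` as the C*-envelope of the tensor algebra `𝒜(X, σ)`: it is a C*-cover and it
is a quotient of every C*-cover, by a `*`-homomorphism compatible with the embeddings. -/
structure IsCStarEnvelope (σ : Fin n → C(X, X)) {E : Type u} [CStarAlgebra E] [PartialOrder E]
    [StarOrderedRing E] (j : CovAlg σ →ₐ[ℂ] E) : Prop extends IsCStarCover σ j where
  minimal : ∀ (D : Type u) [CStarAlgebra D] [PartialOrder D] [StarOrderedRing D]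
    (k : CovAlg σ →ₐ[ℂ] D), IsCStarCover σ k →
      ∃ q : D →⋆ₐ[ℂ] E, Function.Surjective q ∧ ∀ a, q (k a) = j a

end TensorAlg

/-! ### The algebra `𝔅`, the endomorphism `α`, and invariant ideals -/

section Core

variable {X : Type u} [TopologicalSpace X] {n : ℕ}
variable {E : Type u} [CStarAlgebra E]

/-- `π̃` is a realization of `C(X̃)` in the C*-algebra: it extends the given copy of `C(X)`, where
`f ∈ C(X)` is regarded as `f ∘ p ∈ C(X̃)`, and satisfies the covariance relations
`g tᵢ = tᵢ (g ∘ σ̃ᵢ)` of the covering system, where `tᵢ` is the image of `sᵢ`. -/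
structure IsCoverExtension (σ : Fin n → C(X, X)) (j : CovAlg σ →ₐ[ℂ] E)
    (π : C(Cover σ, ℂ) →⋆ₐ[ℂ] E) : Prop where
  extend : ∀ f : C(X, ℂ), π (f.comp (coverProj σ)) = j (coeff σ f)
  covariant : ∀ (g : C(Cover σ, ℂ)) (i : Fin n),
    π g * j (gen σ i) = j (gen σ i) * π (g.comp (coverMap σ i))

/-- `t_w = t_{i₁} ⋯ t_{iₖ}` for the word `w = i₁ ⋯ iₖ`. -/
def wordElt (σ : Fin n → C(X, X)) (j : CovAlg σ →ₐ[ℂ] E) (w : List (Fin n)) : E :=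
  (w.map fun i => j (gen σ i)).prod

/-- The algebra `𝔅`, the closed linear span of all `t_u f t_v^*` with `|u| = |v|` and
`f ∈ C(X̃)`. -/
def core (σ : Fin n → C(X, X)) (j : CovAlg σ →ₐ[ℂ] E) (π : C(Cover σ, ℂ) →⋆ₐ[ℂ] E) :
    Submodule ℂ E :=
  (Submodule.span ℂ {b : E | ∃ (u v : List (Fin n)) (f : C(Cover σ, ℂ)),
    u.length = v.length ∧ b = wordElt σ j u * π f * star (wordElt σ j v)}).topologicalClosure

/-- The isometry `V = n^{-1/2} (t₁ + ⋯ + tₙ)`. -/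
def isom (σ : Fin n → C(X, X)) (j : CovAlg σ →ₐ[ℂ] E) : E :=
  (((Real.sqrt n)⁻¹ : ℝ) : ℂ) • ∑ i, j (gen σ i)

/-- The map `α(b) = V b V^*`. -/
def endo (σ : Fin n → C(X, X)) (j : CovAlg σ →ₐ[ℂ] E) (b : E) : E :=
  isom σ j * b * star (isom σ j)

/-- `J` is a (closed two-sided) ideal of the closed subalgebra `B`. -/
structure IsIdealOf (B J : Submodule ℂ E) : Prop where
  le : J ≤ B
  closed : IsClosed (J : Set E)
  mul_left : ∀ b ∈ B, ∀ x ∈ J, b * x ∈ J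
  mul_right : ∀ b ∈ B, ∀ x ∈ J, x * b ∈ J

/-- `α(J) ⊆ J`. -/
def IsInvariant (α : E → E) (J : Submodule ℂ E) : Prop :=
  ∀ x ∈ J, α x ∈ J

/-- `α(J) ⊆ J`, and `b ∈ J` whenever `b ∈ B` and `α(b) ∈ J`. -/
def IsBiInvariant (α : E → E) (B J : Submodule ℂ E) : Prop :=
  IsInvariant α J ∧ ∀ b ∈ B, α b ∈ J → b ∈ J

end Core

end MvDyn

end

/-! The C*-envelope is given only by its universal property, so the proof first extracts what is
needed: the Cuntz relations `t_i^* t_k = δ_ik`, `∑ t_i t_i^* = 1`, an action of `C(X̃)`, and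
faithfulness on `C(X)`. For this a concrete C*-cover is built. On `ℓ²(X̃ × ℤ)` let `C(X̃)` act by
multiplication and let `s_i` send the basis vector at `(z, m)` to that at `(σ̃_i z, m + 1)`. Every
`z` is `σ̃_i z'` for exactly one pair `(i, z')`, so the Cuntz relations hold. This representation
dominates every row contractive one (`norm_map_le_orbitRep`). After scaling by `r < 1`, the Poisson
transform `ξ ↦ (D T_w^* ξ)_w` dilates such a representation to Fock space, where a polynomial
becomes a matrix over `C(X)`. The value of that matrix at `p(z)` is a compression of the orbit
representation. Hence the orbit algebra is a C*-cover, the envelope is a quotient of it, and the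
relations descend (`IsCStarEnvelope.relations`). Uniqueness of `π` is Stone–Weierstrass on `X̃`. Its
injectivity holds because every nonzero `g`, composed with some `σ̃_w`, divides a nonzero function
pulled back from `X`.

From then on only a Cuntz pair `(t, π)` is used. Compressing to the diagonal by the projections `t_w
t_w^*` with `|w| = l` and letting `l → ∞` gives a contraction of `𝔅` onto `C(X̃)` that preserves
closed ideals. Therefore an ideal meeting `C(X̃)` trivially is zero (`ideal_eq_bot`). If the system
is minimal and an invariant ideal contains a nonzero `g`, then finitely many translates of a
positive function derived from `g` add up to an invertible function. Invariance places all of them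
at one common level of the ideal, so the ideal contains `1` (`one_mem_of_isMinimal`).

If the system is not minimal, the sequences that stay in a proper orbit closure form a nonempty set
`Z ⊆ X̃`, stable under all `σ̃_i` and under the shift. The elements `t_u g t_v^*` with `g` zero on
`Z` span a bi-invariant ideal: stability under `σ̃_i` gives ideal and bi-invariance, and stability
under the shift keeps `1` out (`isMinimal_of_biInvariant`). -/

noncomputable section

namespace MvDyn

/-! ### Norms of operator matrices and of matrices of continuous functions. -/

section MatrixNorms

open scoped InnerProductSpace

variable {I : Type*} [Fintype I]

/-- An operator matrix acting on the Hilbert direct sum. -/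
def opMatrix {H : Type*} [NormedAddCommGroup H] [InnerProductSpace ℂ H]
    (M : CStarMatrix I I (H →L[ℂ] H)) :
    PiLp 2 (fun _ : I => H) →L[ℂ] PiLp 2 (fun _ : I => H) :=
  (PiLp.continuousLinearEquiv 2 ℂ (fun _ : I => H)).symm.toContinuousLinearMap ∘L
    (ContinuousLinearMap.pi fun i => ∑ k, M i k ∘L PiLp.proj 2 (fun _ : I => H) k)

section Hilbert

variable {H : Type*} [NormedAddCommGroup H] [InnerProductSpace ℂ H]

theorem opMatrix_apply (M : CStarMatrix I I (H →L[ℂ] H)) (ξ : PiLp 2 (fun _ : I => H)) (i : I) :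
    opMatrix M ξ i = ∑ k, M i k (ξ k) := by
  simp [opMatrix]

theorem inner_opMatrix (M : CStarMatrix I I (H →L[ℂ] H)) (ξ η : PiLp 2 (fun _ : I => H)) :
    ⟪ξ, opMatrix M η⟫_ℂ = ∑ i, ∑ k, ⟪ξ i, M i k (η k)⟫_ℂ := by
  simp [PiLp.inner_apply, opMatrix_apply, inner_sum]

variable [CompleteSpace H]

/-- The action of operator matrices on the Hilbert direct sum as a `*`-homomorphism. -/
def opMatrixHom : CStarMatrix I I (H →L[ℂ] H) →⋆ₙₐ[ℂ]
    (PiLp 2 (fun _ : I => H) →L[ℂ] PiLp 2 (fun _ : I => H)) where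
  toFun := opMatrix
  map_smul' c M := by
    ext ξ i
    simp [opMatrix_apply, Finset.smul_sum]
  map_zero' := by
    ext ξ i
    simp [opMatrix_apply]
  map_add' M N := by
    ext ξ i
    simp [opMatrix_apply, Finset.sum_add_distrib]
  map_mul' M N := by
    ext ξ i
    simp only [opMatrix_apply, CStarMatrix.mul_apply, sum_apply,
      mul_apply_eq_comp, map_sum]
    rw [Finset.sum_comm]
  map_star' M := by
    rw [ContinuousLinearMap.star_eq_adjoint, ContinuousLinearMap.eq_adjoint_iff]
    intro ξ η
    rw [inner_opMatrix, ← inner_conj_symm, inner_opMatrix, map_sum, Finset.sum_comm]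
    simp only [map_sum, inner_conj_symm]
    refine Finset.sum_congr rfl fun i _ => Finset.sum_congr rfl fun k _ => ?_
    rw [CStarMatrix.star_apply, ContinuousLinearMap.star_eq_adjoint,
      ContinuousLinearMap.adjoint_inner_left]

theorem opMatrixHom_injective [DecidableEq I] :
    Function.Injective (opMatrixHom : CStarMatrix I I (H →L[ℂ] H) →⋆ₙₐ[ℂ] _) := by
  rw [injective_iff_map_eq_zero]
  intro M hM
  ext i k h
  have := congrArg (fun T => T (WithLp.toLp 2 (Pi.single k h)) i) hM
  simpa [opMatrixHom, opMatrix_apply, Pi.single_apply, apply_ite] using this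

/-- Injective `*`-homomorphisms of C*-algebras are isometric, so the abstract C*-norm on matrices is
the operator norm on the Hilbert sum. Matrix norms can then be estimated through the sesquilinear
form in the next two lemmas. -/
theorem norm_opMatrix [DecidableEq I] (M : CStarMatrix I I (H →L[ℂ] H)) : ‖opMatrix M‖ = ‖M‖ :=
  NonUnitalStarAlgHom.norm_map (opMatrixHom : CStarMatrix I I (H →L[ℂ] H) →⋆ₙₐ[ℂ] _)
    opMatrixHom_injective M

theorem norm_sum_inner_le [DecidableEq I] (M : CStarMatrix I I (H →L[ℂ] H))
    (ξ η : PiLp 2 (fun _ : I => H)) :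
    ‖∑ i, ∑ k, ⟪ξ i, M i k (η k)⟫_ℂ‖ ≤ ‖M‖ * (‖ξ‖ * ‖η‖) := by
  rw [← inner_opMatrix, ← norm_opMatrix]
  calc _ ≤ ‖ξ‖ * ‖opMatrix M η‖ := norm_inner_le_norm _ _
    _ ≤ ‖ξ‖ * (‖opMatrix M‖ * ‖η‖) := by gcongr; exact ContinuousLinearMap.le_opNorm _ _
    _ = _ := by ring

theorem norm_le_of_sum_inner_le [DecidableEq I] (M : CStarMatrix I I (H →L[ℂ] H)) {C : ℝ}
    (hC : 0 ≤ C) (h : ∀ ξ η : PiLp 2 (fun _ : I => H),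
      ‖∑ i, ∑ k, ⟪ξ i, M i k (η k)⟫_ℂ‖ ≤ C * (‖ξ‖ * ‖η‖)) : ‖M‖ ≤ C := by
  rw [← norm_opMatrix]
  refine ContinuousLinearMap.opNorm_le_bound _ hC fun η => ?_
  have := h (opMatrix M η) η
  rw [← inner_opMatrix, inner_self_eq_norm_sq_to_K] at this
  norm_cast at this
  rw [abs_of_nonneg (by positivity)] at this
  rcases (norm_nonneg (opMatrix M η)).eq_or_lt with h0 | h0
  · rw [← h0]; positivity
  · nlinarith

end Hilbert

/-- The value of a matrix of continuous functions at a point. -/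
def matrixAt {Y : Type*} [TopologicalSpace Y] (y : Y) :
    CStarMatrix I I C(Y, ℂ) →⋆ₙₐ[ℂ] Matrix I I ℂ where
  toFun A := Matrix.of fun i k => A i k y
  map_smul' c A := rfl
  map_zero' := rfl
  map_add' A B := rfl
  map_mul' A B := by
    ext i k
    simp [CStarMatrix.mul_apply, Matrix.mul_apply]
  map_star' A := rfl

/-- The action of a scalar matrix on Euclidean space. -/
def euclideanAction [DecidableEq I] :
    Matrix I I ℂ →⋆ₙₐ[ℂ] (EuclideanSpace ℂ I →L[ℂ] EuclideanSpace ℂ I) :=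
  (Matrix.toEuclideanCLM (n := I) (𝕜 := ℂ)).toStarAlgHom.toNonUnitalStarAlgHom

theorem continuous_euclideanAction [DecidableEq I] :
    Continuous (euclideanAction : Matrix I I ℂ → (EuclideanSpace ℂ I →L[ℂ] EuclideanSpace ℂ I)) :=
  (LinearMap.continuous_of_finiteDimensional
    (Matrix.toEuclideanCLM (n := I) (𝕜 := ℂ)).toAlgEquiv.toLinearMap :)

theorem euclideanAction_injective [DecidableEq I] :
    Function.Injective
      (euclideanAction : Matrix I I ℂ → (EuclideanSpace ℂ I →L[ℂ] EuclideanSpace ℂ I)) :=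
  (Matrix.toEuclideanCLM (n := I) (𝕜 := ℂ)).injective

theorem euclideanAction_apply [DecidableEq I] (M : Matrix I I ℂ) (η : EuclideanSpace ℂ I) (i : I) :
    euclideanAction M η i = ∑ k, M i k * η k := by
  change (Matrix.toEuclideanCLM (n := I) (𝕜 := ℂ) M η) i = _
  rw [Matrix.ofLp_toEuclideanCLM]
  rfl

/-- A matrix of continuous functions as an operator valued continuous function. -/
def matrixEval {Y : Type*} [TopologicalSpace Y] [CompactSpace Y] [DecidableEq I] :
    CStarMatrix I I C(Y, ℂ) →⋆ₙₐ[ℂ] C(Y, EuclideanSpace ℂ I →L[ℂ] EuclideanSpace ℂ I) where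
  toFun A :=
    { toFun := fun y => euclideanAction (matrixAt y A)
      continuous_toFun :=
        continuous_euclideanAction.comp <| continuous_matrix fun i k => (A i k).continuous }
  map_smul' c A := ContinuousMap.ext fun y => by
    simp only [ContinuousMap.coe_mk, map_smul]; rfl
  map_zero' := ContinuousMap.ext fun y => by
    simp only [ContinuousMap.coe_mk, map_zero]; rfl
  map_add' A B := ContinuousMap.ext fun y => by
    simp only [ContinuousMap.coe_mk, map_add]; rfl
  map_mul' A B := ContinuousMap.ext fun y => by
    simp only [ContinuousMap.coe_mk, map_mul]; rfl
  map_star' A := ContinuousMap.ext fun y => by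
    simp only [ContinuousMap.coe_mk, map_star]; rfl

/-- The norm of the image of a matrix of continuous functions under a `*`-homomorphism is bounded
by the supremum of the norms of its values. -/
theorem norm_map_le_of_eval_le {Y : Type*} [TopologicalSpace Y] [CompactSpace Y]
    [DecidableEq I] {B : Type*} [CStarAlgebra B] (ψ : CStarMatrix I I C(Y, ℂ) →⋆ₙₐ[ℂ] B)
    (A : CStarMatrix I I C(Y, ℂ)) {C : ℝ} (hC : 0 ≤ C)
    (h : ∀ (y : Y) (ξ η : EuclideanSpace ℂ I),
      ‖∑ i, ∑ k, star (ξ i) * (A i k y * η k)‖ ≤ C * (‖ξ‖ * ‖η‖)) : ‖ψ A‖ ≤ C := by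
  let _ : PartialOrder C(Y, ℂ) := CStarAlgebra.spectralOrder _
  have _ : StarOrderedRing C(Y, ℂ) := CStarAlgebra.spectralOrderedRing _
  have hinj : Function.Injective (matrixEval : CStarMatrix I I C(Y, ℂ) →⋆ₙₐ[ℂ] _) := by
    rw [injective_iff_map_eq_zero]
    intro M hM
    ext i k y
    have h1 : euclideanAction (matrixAt y M) = 0 :=
      congrArg (fun F : C(Y, EuclideanSpace ℂ I →L[ℂ] EuclideanSpace ℂ I) => F y) hM
    rw [map_eq_zero_iff _ euclideanAction_injective] at h1
    exact congrFun (congrFun h1 i) k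
  -- `ψ` is contractive and `matrixEval` is isometric, which leaves a bound at each point `y`.
  refine (NonUnitalStarAlgHom.norm_apply_le ψ A).trans ?_
  rw [← NonUnitalStarAlgHom.norm_map matrixEval hinj, ContinuousMap.norm_le _ hC]
  intro y
  refine ContinuousLinearMap.opNorm_le_bound _ hC fun η => ?_
  set T := matrixEval A y with hT
  have hval : ∀ i, T η i = ∑ k, A i k y * η k := euclideanAction_apply _ η
  -- Testing against `ξ = T η` turns the form bound into `‖T η‖² ≤ C ‖T η‖ ‖η‖`.
  have := h y (T η) η
  have e : ∑ i, ∑ k, star ((T η) i) * (A i k y * η k) = ⟪T η, T η⟫_ℂ := by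
    rw [PiLp.inner_apply]
    refine Finset.sum_congr rfl fun i _ => ?_
    rw [← Finset.mul_sum, ← hval]
    rw [mul_comm]
    rfl
  rw [e, inner_self_eq_norm_sq_to_K] at this
  norm_cast at this
  rw [abs_of_nonneg (by positivity)] at this
  rcases (norm_nonneg (T η)).eq_or_lt with h0 | h0
  · rw [← h0]; positivity
  · nlinarith

end MatrixNorms

/-! ### Topology and dynamics of the covering space. -/

section CoverSpace

variable {X : Type u} [TopologicalSpace X] {n : ℕ} {σ : Fin n → C(X, X)}

/-- The first index `i₀` of a point of the covering space. -/
def firstIndex (z : Cover σ) : Fin n := z.1.1 0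

theorem continuous_firstIndex : Continuous (firstIndex : Cover σ → Fin n) :=
  (continuous_apply 0).comp (continuous_fst.comp continuous_subtype_val)

/-- The shift `((i₀, i₁, …), (x₀, x₁, …)) ↦ ((i₁, i₂, …), (x₁, x₂, …))`. -/
def shift (σ : Fin n → C(X, X)) : C(Cover σ, Cover σ) where
  toFun z := ⟨(fun k => z.1.1 (k + 1), fun k => z.1.2 (k + 1)), fun k => z.2 (k + 1)⟩
  continuous_toFun := by
    have h1 : Continuous fun z : Cover σ => z.1.1 := continuous_fst.comp continuous_subtype_val
    have h2 : Continuous fun z : Cover σ => z.1.2 := continuous_snd.comp continuous_subtype_val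
    exact Continuous.subtype_mk (Continuous.prodMk
      (continuous_pi fun k => (continuous_apply _).comp h1)
      (continuous_pi fun k => (continuous_apply _).comp h2)) _

theorem Cover.ext' {z z' : Cover σ} (h1 : ∀ k, z.1.1 k = z'.1.1 k)
    (h2 : ∀ k, z.1.2 k = z'.1.2 k) : z = z' :=
  Subtype.ext (Prod.ext (funext h1) (funext h2))

@[simp] theorem shift_coverMap (i : Fin n) (z : Cover σ) : shift σ (coverMap σ i z) = z := rfl

@[simp] theorem firstIndex_coverMap (i : Fin n) (z : Cover σ) :
    firstIndex (coverMap σ i z) = i := rfl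

@[simp] theorem coverProj_coverMap (i : Fin n) (z : Cover σ) :
    coverProj σ (coverMap σ i z) = σ i (coverProj σ z) := rfl

@[simp] theorem coverMap_firstIndex (z : Cover σ) :
    coverMap σ (firstIndex z) (shift σ z) = z := by
  refine Cover.ext' (fun k => ?_) (fun k => ?_) <;> cases k
  · rfl
  · rfl
  · exact z.2 0
  · rfl

theorem coverMap_injective (i : Fin n) : Function.Injective (coverMap σ i) :=
  Function.LeftInverse.injective (g := shift σ) (shift_coverMap i)

/-- `σ̃_w` for a word `w`. -/
def coverWord (σ : Fin n → C(X, X)) : List (Fin n) → C(Cover σ, Cover σ)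
  | [] => ContinuousMap.id _
  | i :: w => (coverMap σ i).comp (coverWord σ w)

@[simp] theorem coverWord_nil (z : Cover σ) : coverWord σ [] z = z := rfl

@[simp] theorem coverWord_cons (i : Fin n) (w : List (Fin n)) (z : Cover σ) :
    coverWord σ (i :: w) z = coverMap σ i (coverWord σ w z) := rfl

theorem coverProj_coverWord (w : List (Fin n)) (z : Cover σ) :
    coverProj σ (coverWord σ w z) = wordMap σ w (coverProj σ z) := by
  induction w with
  | nil => rfl
  | cons i w ih => rw [coverWord_cons, coverProj_coverMap, ih]; rfl

theorem coverWord_append (v w : List (Fin n)) (z : Cover σ) :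
    coverWord σ (v ++ w) z = coverWord σ v (coverWord σ w z) := by
  induction v with
  | nil => rfl
  | cons i v ih => simp [ih]

/-- A point `σ̃_v z` records `v` in its first `|v|` indices, and shifting recovers `z`. For words of
different lengths this can fail, for instance at periodic points. The integer coordinate of the
orbit representation compensates for that. -/
theorem coverWord_inj_of_length {v w : List (Fin n)} (h : v.length = w.length) {z z' : Cover σ}
    (e : coverWord σ v z = coverWord σ w z') : v = w ∧ z = z' := by
  induction v generalizing w with
  | nil =>
    cases w with
    | nil => exact ⟨rfl, e⟩
    | cons => simp at h
  | cons i v ih =>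
    cases w with
    | nil => simp at h
    | cons k w =>
      have h1 : i = k := congrArg firstIndex e
      have h2 : coverWord σ v z = coverWord σ w z' := congrArg (shift σ) e
      obtain ⟨h3, h4⟩ := ih (by simpa using h) h2
      exact ⟨by rw [h1, h3], h4⟩

theorem continuous_coverPoint (k : ℕ) : Continuous fun z : Cover σ => z.1.2 k :=
  (continuous_apply k).comp (continuous_snd.comp continuous_subtype_val)

theorem continuous_coverIndex (k : ℕ) : Continuous fun z : Cover σ => z.1.1 k :=
  (continuous_apply k).comp (continuous_fst.comp continuous_subtype_val)

theorem coverProj_iterate_shift (k : ℕ) (z : Cover σ) :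
    coverProj σ ((shift σ)^[k] z) = z.1.2 k := by
  induction k generalizing z with
  | zero => rfl
  | succ k ih => rw [Function.iterate_succ_apply, ih]; rfl

theorem firstIndex_iterate_shift (k : ℕ) (z : Cover σ) :
    firstIndex ((shift σ)^[k] z) = z.1.1 k := by
  induction k generalizing z with
  | zero => rfl
  | succ k ih => rw [Function.iterate_succ_apply, ih]; rfl

theorem exists_coverWord_iterate_shift (k : ℕ) (z : Cover σ) :
    ∃ w : List (Fin n), w.length = k ∧ coverWord σ w ((shift σ)^[k] z) = z := by
  induction k generalizing z with
  | zero => exact ⟨[], rfl, rfl⟩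
  | succ k ih =>
    obtain ⟨w, hw, e⟩ := ih (shift σ z)
    refine ⟨firstIndex z :: w, by simp [hw], ?_⟩
    rw [Function.iterate_succ_apply, coverWord_cons, e, coverMap_firstIndex]

instance [T2Space X] : T2Space (Cover σ) :=
  inferInstanceAs (T2Space
    {z : (ℕ → Fin n) × (ℕ → X) // ∀ k, σ (z.1 k) (z.2 (k + 1)) = z.2 k})

instance [CompactSpace X] [T2Space X] : CompactSpace (Cover σ) := by
  have hclosed : IsClosed {z : (ℕ → Fin n) × (ℕ → X) | ∀ k, σ (z.1 k) (z.2 (k + 1)) = z.2 k} := by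
    rw [Set.ofPred_forall]
    refine isClosed_iInter fun k => ?_
    have h : {z : (ℕ → Fin n) × (ℕ → X) | σ (z.1 k) (z.2 (k + 1)) = z.2 k} =
        ⋃ i : Fin n, {z | z.1 k = i} ∩ {z | σ i (z.2 (k + 1)) = z.2 k} := by
      ext z
      simp
    rw [h]
    refine isClosed_iUnion_of_finite fun i => IsClosed.inter ?_ ?_
    · exact isClosed_eq ((continuous_apply k).comp continuous_fst) continuous_const
    · exact isClosed_eq ((σ i).continuous.comp ((continuous_apply _).comp continuous_snd))
        ((continuous_apply _).comp continuous_snd)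
  exact isCompact_iff_compactSpace.mp hclosed.isCompact

theorem coverProj_surjective (hσ : IsSurjective σ) : Function.Surjective (coverProj σ) := by
  have h : ∀ x : X, ∃ q : Fin n × X, σ q.1 q.2 = x := fun x => by
    have hx : x ∈ ⋃ i, Set.range (σ i) := by rw [hσ]; trivial
    obtain ⟨i, y, hy⟩ := Set.mem_iUnion.mp hx
    exact ⟨(i, y), hy⟩
  choose f hf using h
  intro x
  let pts : ℕ → X := fun k => (fun y => (f y).2)^[k] x
  refine ⟨⟨(fun k => (f (pts k)).1, pts), fun k => ?_⟩, rfl⟩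
  have : pts (k + 1) = (f (pts k)).2 := Function.iterate_succ_apply' _ _ _
  change σ (f (pts k)).1 (pts (k + 1)) = pts k
  rw [this]
  exact hf _

/-- The indicator function of the set of points with first index `i`. -/
def indexIndicator (σ : Fin n → C(X, X)) (i : Fin n) : C(Cover σ, ℂ) where
  toFun z := if firstIndex z = i then 1 else 0
  continuous_toFun :=
    (continuous_of_discreteTopology (f := fun k : Fin n => if k = i then (1 : ℂ) else 0)).comp
      continuous_firstIndex

theorem indexIndicator_comp_coverMap (i k : Fin n) :
    (indexIndicator σ i).comp (coverMap σ k) = if k = i then 1 else 0 := by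
  ext z
  change (if k = i then (1 : ℂ) else 0) = _
  split_ifs <;> rfl

/-- A closed `*`-subalgebra of `C(X̃)` that contains the functions on `X` and the indicator
functions of the first index, and that is invariant under the shift, is everything. -/
theorem starSubalgebra_cover_eq_top [CompactSpace X] [T2Space X]
    (S : StarSubalgebra ℂ C(Cover σ, ℂ)) (hS : IsClosed (S : Set C(Cover σ, ℂ)))
    (h1 : ∀ f : C(X, ℂ), f.comp (coverProj σ) ∈ S) (h2 : ∀ i, indexIndicator σ i ∈ S)
    (h3 : ∀ g ∈ S, g.comp (shift σ) ∈ S) : S = ⊤ := by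
  have h3' : ∀ (k : ℕ), ∀ g ∈ S, ∃ g' ∈ S, ∀ z, g' z = g ((shift σ)^[k] z) := by
    intro k
    induction k with
    | zero => exact fun g hg => ⟨g, hg, fun _ => rfl⟩
    | succ k ih =>
      intro g hg
      obtain ⟨g', hg', e⟩ := ih g hg
      exact ⟨_, h3 g' hg', fun z => by
        rw [ContinuousMap.comp_apply, e, Function.iterate_succ_apply]⟩
  have hsep : S.SeparatesPoints := by
    -- Points of `X̃` differ in some index `i_k` or some `x_k`. The `k`-th shift moves that
    -- coordinate to position `0`, where an indicator or a function on `X` detects it.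
    intro z z' hne
    by_contra hcon
    push Not at hcon
    have hcon' : ∀ g ∈ S, g z = g z' := fun g hg => hcon _ ⟨g, hg, rfl⟩
    refine hne (Cover.ext' (fun k => ?_) (fun k => ?_))
    · obtain ⟨g', hg', e⟩ := h3' k _ (h2 (z'.1.1 k))
      have := hcon' g' hg'
      rw [e, e] at this
      change (if firstIndex _ = _ then (1 : ℂ) else 0) = if firstIndex _ = _ then (1 : ℂ) else 0
        at this
      rw [firstIndex_iterate_shift, firstIndex_iterate_shift, if_pos rfl] at this
      by_contra h
      rw [if_neg h] at this
      exact zero_ne_one this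
    · by_contra h
      obtain ⟨f, hf0, hf1, -⟩ := exists_continuous_zero_one_of_isClosed
        (isClosed_singleton (x := z.1.2 k)) (isClosed_singleton (x := z'.1.2 k)) (by simpa using h)
      obtain ⟨g', hg', e⟩ := h3' k _ (h1 ((⟨Complex.ofReal, Complex.continuous_ofReal⟩ :
        C(ℝ, ℂ)).comp f))
      have := hcon' g' hg'
      rw [e, e] at this
      simp only [ContinuousMap.comp_apply, coverProj_iterate_shift] at this
      rw [hf0 rfl, hf1 rfl] at this
      simp at this
  have := ContinuousMap.starSubalgebra_topologicalClosure_eq_top_of_separatesPoints S hsep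
  exact top_unique (this ▸ S.topologicalClosure_minimal le_rfl hS)

/-- The images `σ̃_w(p⁻¹(O))` of open sets `O` form a basis of neighborhoods in `X̃`. -/
theorem exists_coverWord_mem [CompactSpace X] [T2Space X] {U : Set (Cover σ)} (hU : IsOpen U)
    {z : Cover σ} (hz : z ∈ U) :
    ∃ (w : List (Fin n)) (x : X) (O : Set X), IsOpen O ∧ x ∈ O ∧
      ∀ y : Cover σ, coverProj σ y ∈ O → coverWord σ w y ∈ U := by
  -- The point `x_k` and the indices before `k` determine all `x_m` with `m ≤ k`. Hence the closed
  -- sets `T k` decrease to `{z}`, and compactness puts one of them inside `U`.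
  let T : ℕ → Set (Cover σ) := fun k => {y | y.1.2 k = z.1.2 k} ∩ {y | ∀ m < k, y.1.1 m = z.1.1 m}
  have hTc : ∀ k, IsClosed (T k) := fun k => by
    refine (isClosed_eq (continuous_coverPoint k) continuous_const).inter ?_
    have : {y : Cover σ | ∀ m < k, y.1.1 m = z.1.1 m} =
        ⋂ m, ⋂ (_ : m < k), {y | y.1.1 m = z.1.1 m} := by ext; simp
    rw [this]
    exact isClosed_iInter fun m => isClosed_iInter fun _ => isClosed_eq
      (continuous_coverIndex m) continuous_const
  have hTanti : ∀ k, T (k + 1) ⊆ T k := fun k y hy => by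
    refine ⟨?_, fun m hm => hy.2 m (by omega)⟩
    have e1 : y.1.2 (k + 1) = z.1.2 (k + 1) := hy.1
    have e2 : y.1.1 k = z.1.1 k := hy.2 k (by omega)
    change y.1.2 k = z.1.2 k
    rw [← y.2 k, ← z.2 k, e1, e2]
  have hTinter : (⋂ k, T k) ⊆ U := fun y hy => by
    have : y = z := Cover.ext' (fun k => (Set.mem_iInter.mp hy (k + 1)).2 k (by omega))
      (fun k => (Set.mem_iInter.mp hy k).1)
    rwa [this]
  obtain ⟨k, hk⟩ : ∃ k, T k ⊆ U := by
    refine exists_subset_nhds_of_compactSpace (V := T) ?_ hTc ?_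
    · exact (antitone_nat_of_succ_le hTanti).directed_ge
    · exact fun y hy => hU.mem_nhds (hTinter hy)
  obtain ⟨w, hw, e⟩ := exists_coverWord_iterate_shift k z
  have hsub : ∀ y : Cover σ, coverProj σ y = z.1.2 k → coverWord σ w y ∈ U := by
    intro y hy
    refine hk ?_
    have aux : ∀ (w : List (Fin n)) (z z' : Cover σ), z.1.2 0 = z'.1.2 0 →
        (coverWord σ w z).1.2 w.length = (coverWord σ w z').1.2 w.length ∧
        ∀ m < w.length, (coverWord σ w z).1.1 m = (coverWord σ w z').1.1 m := by
      intro w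
      induction w with
      | nil => exact fun z z' h => ⟨h, fun m hm => by simp at hm⟩
      | cons i w ih =>
        intro z z' h
        refine ⟨(ih z z' h).1, fun m hm => ?_⟩
        cases m with
        | zero => rfl
        | succ m => exact (ih z z' h).2 m (by simpa using hm)
    have := aux w y ((shift σ)^[k] z) (by
      rw [show y.1.2 0 = z.1.2 k from hy]; exact (coverProj_iterate_shift k z).symm)
    rw [e, hw] at this
    exact this
  -- The whole fibre of `p` over `x_k` is mapped into `U`. Since `p` is a closed map, the same holds
  -- over a neighborhood of `x_k`, namely the complement of the image of the bad set.
  refine ⟨w, z.1.2 k, (coverProj σ '' (coverWord σ w ⁻¹' U)ᶜ)ᶜ, ?_, ?_, ?_⟩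
  · rw [isOpen_compl_iff]
    exact ((hU.preimage (coverWord σ w).continuous).isClosed_compl.isCompact.image
      (coverProj σ).continuous).isClosed
  · rintro ⟨y, hy, hyz⟩
    exact hy (hsub y hyz)
  · intro y hy
    by_contra h
    exact hy ⟨y, h, rfl⟩

/-- Every nonzero function on the covering space divides, after composition with some `σ̃_w`,
a nonzero positive function on `X`. -/
theorem exists_mul_comp_coverWord [CompactSpace X] [T2Space X] {g : C(Cover σ, ℂ)} (hg : g ≠ 0) :
    ∃ (w : List (Fin n)) (f : C(X, ℝ)) (h : C(Cover σ, ℂ)), (∀ x, 0 ≤ f x) ∧ (∃ x, f x = 1) ∧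
      h * g.comp (coverWord σ w) =
        ((⟨Complex.ofReal, Complex.continuous_ofReal⟩ : C(ℝ, ℂ)).comp f).comp (coverProj σ) := by
  obtain ⟨z, hz⟩ : ∃ z, g z ≠ 0 := by
    by_contra hcon
    push Not at hcon
    exact hg (ContinuousMap.ext hcon)
  have hpos : 0 < ‖g z‖ ^ 2 := by positivity
  obtain ⟨w, x, O, hO, hxO, hw⟩ := exists_coverWord_mem (σ := σ)
    (U := {y | ‖g z‖ ^ 2 / 2 < ‖g y‖ ^ 2})
    (isOpen_lt continuous_const (by fun_prop)) (z := z) (half_lt_self hpos)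
  obtain ⟨f, hf0, hf1, hf⟩ := exists_continuous_zero_one_of_isClosed
    hO.isClosed_compl (isClosed_singleton (x := x)) (by simpa using hxO)
  have hden : ∀ y, (max (‖g (coverWord σ w y)‖ ^ 2) (‖g z‖ ^ 2 / 2) : ℝ) ≠ 0 := fun y =>
    (lt_max_of_lt_right (by positivity)).ne'
  -- The maximum keeps the denominator away from zero. It equals `|g ∘ σ̃_w|²` wherever `f ∘ p` is
  -- nonzero, so there `h` is `f ∘ p` divided by `g ∘ σ̃_w`.
  let h : C(Cover σ, ℂ) :=
    { toFun := fun y => (f (coverProj σ y) : ℂ) * star (g (coverWord σ w y)) /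
        ((max (‖g (coverWord σ w y)‖ ^ 2) (‖g z‖ ^ 2 / 2) : ℝ) : ℂ)
      continuous_toFun := by
        refine Continuous.div (by fun_prop) (by fun_prop) fun y => ?_
        exact_mod_cast hden y }
  refine ⟨w, f, h, fun y => (hf y).1, ⟨x, hf1 rfl⟩, ?_⟩
  ext y
  change (f (coverProj σ y) : ℂ) * star (g (coverWord σ w y)) /
        ((max (‖g (coverWord σ w y)‖ ^ 2) (‖g z‖ ^ 2 / 2) : ℝ) : ℂ) * g (coverWord σ w y) =
        (f (coverProj σ y) : ℂ)
  by_cases hy : coverProj σ y ∈ O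
  · have h1 : ‖g z‖ ^ 2 / 2 < ‖g (coverWord σ w y)‖ ^ 2 := hw y hy
    have h2 : star (g (coverWord σ w y)) * g (coverWord σ w y) =
        ((‖g (coverWord σ w y)‖ ^ 2 : ℝ) : ℂ) := by
      have := Complex.conj_mul' (g (coverWord σ w y))
      rw [Complex.ofReal_pow]
      exact this
    rw [div_mul_eq_mul_div, mul_assoc, h2, max_eq_left h1.le, mul_div_assoc, div_self, mul_one]
    exact_mod_cast ((half_pos hpos).trans h1).ne'
  · rw [hf0 hy]
    simp

end CoverSpace

/-! ### Words and polynomials in the covariance algebra. -/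

section Words

/-- Prepending a letter to a word. -/
def consEmbedding (n : ℕ) : Fin n × List (Fin n) ↪ List (Fin n) where
  toFun p := p.1 :: p.2
  inj' p q h := by simpa [Prod.ext_iff] using h

@[simp] theorem consEmbedding_apply {n : ℕ} (p : Fin n × List (Fin n)) :
    consEmbedding n p = p.1 :: p.2 := rfl

/-- The words of length `k`. -/
def words (n : ℕ) : ℕ → Finset (List (Fin n))
  | 0 => {[]}
  | k + 1 => (Finset.univ ×ˢ words n k).map (consEmbedding n)

variable {n : ℕ}

@[simp] theorem mem_words {k : ℕ} {w : List (Fin n)} : w ∈ words n k ↔ w.length = k := by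
  induction k generalizing w with
  | zero => simp [words]
  | succ k ih => cases w <;> simp [words, ih]

@[simp] theorem sum_words_zero {M : Type*} [AddCommMonoid M] (F : List (Fin n) → M) :
    ∑ w ∈ words n 0, F w = F [] := by simp [words]

theorem sum_words_succ {M : Type*} [AddCommMonoid M] (k : ℕ) (F : List (Fin n) → M) :
    ∑ w ∈ words n (k + 1), F w = ∑ i, ∑ w ∈ words n k, F (i :: w) := by
  simp [words, Finset.sum_product]

end Words

section Rep

variable {X : Type u} [TopologicalSpace X] {n : ℕ} {σ : Fin n → C(X, X)}

/-- A representation of the covariance algebra from a covariant pair. -/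
def mkRep {A : Type*} [Ring A] [Algebra ℂ A] (φ : C(X, ℂ) →ₐ[ℂ] A) (s : Fin n → A)
    (h : ∀ f i, φ f * s i = s i * φ (f.comp (σ i))) : CovAlg σ →ₐ[ℂ] A :=
  RingQuot.liftAlgHom ℂ ⟨FreeAlgebra.lift ℂ (Sum.elim φ s), by
    intro x y hxy
    cases hxy with
    | scalar c => simp
    | add f g => simp
    | mul f g => simp
    | cov f i => simp [h]⟩

section UniversalProperty

variable {A : Type*} [Ring A] [Algebra ℂ A] (φ : C(X, ℂ) →ₐ[ℂ] A) (s : Fin n → A)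
    (h : ∀ f i, φ f * s i = s i * φ (f.comp (σ i)))

@[simp] theorem mkRep_coeff (f : C(X, ℂ)) : mkRep φ s h (coeff σ f) = φ f := by
  change RingQuot.liftAlgHom ℂ _ (RingQuot.mkAlgHom ℂ _ _) = _
  simp

@[simp] theorem mkRep_gen (i : Fin n) : mkRep φ s h (gen σ i) = s i := by
  change RingQuot.liftAlgHom ℂ _ (RingQuot.mkAlgHom ℂ _ _) = _
  simp

end UniversalProperty

/-- The monomial `s_w`. -/
def genWord (σ : Fin n → C(X, X)) (w : List (Fin n)) : CovAlg σ := (w.map (gen σ)).prod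

@[simp] theorem genWord_nil : genWord σ [] = 1 := rfl

@[simp] theorem genWord_cons (i : Fin n) (w : List (Fin n)) :
    genWord σ (i :: w) = gen σ i * genWord σ w := by simp [genWord]

/-- Composition with `σ_w`. -/
def compWord (σ : Fin n → C(X, X)) : List (Fin n) → C(X, ℂ) → C(X, ℂ)
  | [], f => f
  | i :: w, f => compWord σ w (f.comp (σ i))

theorem compWord_apply (w : List (Fin n)) (f : C(X, ℂ)) (x : X) :
    compWord σ w f x = f (wordMap σ w x) := by
  induction w generalizing f with
  | nil => rfl
  | cons i w ih => rw [compWord, ih]; rfl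

theorem coeff_mul_genWord (f : C(X, ℂ)) (w : List (Fin n)) :
    coeff σ f * genWord σ w = genWord σ w * coeff σ (compWord σ w f) := by
  induction w generalizing f with
  | nil => simp [compWord]
  | cons i w ih =>
    rw [genWord_cons, ← mul_assoc, coeff_mul_gen, mul_assoc, ih, ← mul_assoc, compWord]

/-- The polynomial `∑ s_w f_w` with finitely supported coefficients. -/
def poly (c : List (Fin n) →₀ C(X, ℂ)) : CovAlg σ := c.sum fun w f => genWord σ w * coeff σ f

theorem poly_single (w : List (Fin n)) (f : C(X, ℂ)) :
    (poly (Finsupp.single w f) : CovAlg σ) = genWord σ w * coeff σ f := by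
  simp [poly]

theorem poly_add (c d : List (Fin n) →₀ C(X, ℂ)) : (poly (c + d) : CovAlg σ) = poly c + poly d :=
  Finsupp.sum_add_index' (by simp) (by simp [mul_add])

/-- Every element of the covariance algebra is a polynomial. -/
theorem exists_poly (a : CovAlg σ) : ∃ c, a = poly c := by
  obtain ⟨b, rfl⟩ := RingQuot.mkAlgHom_surjective ℂ (CovRel σ) a
  -- The set of polynomials contains `1`, so it suffices that it is stable under left
  -- multiplication, which can be checked on generators.
  suffices h : ∀ b : FreeAlgebra ℂ (C(X, ℂ) ⊕ Fin n), ∀ c : List (Fin n) →₀ C(X, ℂ),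
      ∃ d, RingQuot.mkAlgHom ℂ (CovRel σ) b * poly c = poly d by
    obtain ⟨d, hd⟩ := h b (Finsupp.single [] 1)
    exact ⟨d, by rw [← hd, poly_single]; simp⟩
  intro b
  have key : ∀ x : CovAlg σ, (∀ w f, ∃ d, x * poly (Finsupp.single w f) = poly d) →
      ∀ c : List (Fin n) →₀ C(X, ℂ), ∃ d, x * poly c = poly d := by
    intro x hx c
    induction c using Finsupp.induction_linear with
    | zero => exact ⟨0, by simp [poly]⟩
    | add c d hc hd =>
      obtain ⟨c', hc'⟩ := hc
      obtain ⟨d', hd'⟩ := hd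
      exact ⟨c' + d', by rw [poly_add, poly_add, mul_add, hc', hd']⟩
    | single w f => exact hx w f
  induction b using FreeAlgebra.induction with
  | grade0 r =>
    refine key _ fun w f => ⟨Finsupp.single w (r • f), ?_⟩
    rw [poly_single, poly_single, AlgHom.commutes, map_smul, mul_smul_comm, Algebra.smul_def]
  | grade1 x =>
    refine key _ fun w f => ?_
    cases x with
    | inl g =>
      refine ⟨Finsupp.single w (compWord σ w g * f), ?_⟩
      rw [poly_single, poly_single, map_mul, ← mul_assoc, ← mul_assoc, ← coeff_mul_genWord]
      rfl
    | inr i =>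
      refine ⟨Finsupp.single (i :: w) f, ?_⟩
      rw [poly_single, poly_single, genWord_cons, mul_assoc]
      rfl
  | mul a b ha hb =>
    intro c
    obtain ⟨d, hd⟩ := hb c
    obtain ⟨e, he⟩ := ha d
    exact ⟨e, by rw [map_mul, mul_assoc, hd, he]⟩
  | add a b ha hb =>
    intro c
    obtain ⟨d, hd⟩ := hb c
    obtain ⟨e, he⟩ := ha c
    exact ⟨e + d, by rw [map_add, add_mul, hd, he, poly_add]⟩

end Rep

/-! ### Operators on square summable functions. -/

section SquareSummable

open scoped InnerProductSpace

variable {I : Type u}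

/-- The Hilbert space of square summable functions. -/
abbrev L2 (I : Type u) : Type u := lp (fun _ : I => ℂ) 2

open Classical in
/-- The standard orthonormal basis vectors. -/
def basisVec (y : I) : L2 I := lp.single 2 y 1

open Classical in
theorem basisVec_apply (y z : I) : basisVec y z = if z = y then 1 else 0 := by
  rw [basisVec, lp.single_apply, Pi.single_apply]

theorem inner_basisVec_left (y : I) (h : L2 I) : ⟪basisVec y, h⟫_ℂ = h y := by
  classical
  rw [basisVec, lp.inner_single_left]
  simp

theorem orthonormal_basisVec : Orthonormal ℂ (basisVec : I → L2 I) := by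
  classical
  rw [orthonormal_iff_ite]
  intro y z
  rw [inner_basisVec_left, basisVec_apply]

theorem clm_ext_basisVec {F : Type*} [NormedAddCommGroup F] [NormedSpace ℂ F]
    {S T : L2 I →L[ℂ] F} (h : ∀ y, S (basisVec y) = T (basisVec y)) : S = T := by
  classical
  refine lp.ext_continuousLinearMap (by simp) fun y => ?_
  ext
  simpa [basisVec] using h y

/-- The isometry induced by an injective map of the basis. -/
def basisIsometry {φ : I → I} (hφ : Function.Injective φ) : L2 I →ₗᵢ[ℂ] L2 I :=
  (orthonormal_basisVec.comp φ hφ).orthogonalFamily.linearIsometry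

theorem basisIsometry_basisVec {φ : I → I} (hφ : Function.Injective φ) (y : I) :
    basisIsometry hφ (basisVec y) = basisVec (φ y) := by
  classical
  rw [basisIsometry, basisVec, OrthogonalFamily.linearIsometry_apply_single]
  simp

variable {Y : Type*} [TopologicalSpace Y] [CompactSpace Y]

theorem norm_mul_le_norm_smul (g : C(Y, ℂ)) (y : Y) (c : ℂ) : ‖g y * c‖ ≤ ‖(‖g‖ : ℂ) * c‖ := by
  rw [norm_mul, norm_mul]
  gcongr
  simpa using g.norm_coe_le_norm y

/-- Multiplication by a continuous function along a map of the index set. -/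
def mulOp (r : I → Y) (g : C(Y, ℂ)) : L2 I →L[ℂ] L2 I :=
  LinearMap.mkContinuous
    { toFun := fun h => ⟨fun y => g (r y) * h y,
        ((lp.memℓp h).const_mul (‖g‖ : ℂ)).mono' fun y => norm_mul_le_norm_smul g (r y) (h y)⟩
      map_add' := fun h k => by ext y; exact mul_add _ _ _
      map_smul' := fun c h => by ext y; exact mul_left_comm _ _ _ } ‖g‖ fun h => by
    have := lp.norm_mono (p := 2) two_ne_zero (y := (‖g‖ : ℂ) • h)
      (x := ⟨fun y => g (r y) * h y, ((lp.memℓp h).const_mul (‖g‖ : ℂ)).mono' fun y =>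
        norm_mul_le_norm_smul g (r y) (h y)⟩) fun y => norm_mul_le_norm_smul g (r y) (h y)
    rw [norm_smul] at this
    simpa using this

theorem mulOp_apply (r : I → Y) (g : C(Y, ℂ)) (h : L2 I) (y : I) :
    mulOp r g h y = g (r y) * h y := rfl

theorem mulOp_basisVec (r : I → Y) (g : C(Y, ℂ)) (y : I) :
    mulOp r g (basisVec y) = g (r y) • basisVec y := by
  classical
  ext z
  rw [mulOp_apply, lp.coeFn_smul, Pi.smul_apply, basisVec_apply]
  split_ifs with h
  · rw [h]; rfl
  · simp

/-- Multiplication operators as a `*`-homomorphism. -/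
def mulHom (r : I → Y) : C(Y, ℂ) →⋆ₐ[ℂ] (L2 I →L[ℂ] L2 I) where
  toFun := mulOp r
  map_one' := by ext h y; exact one_mul _
  map_mul' f g := by ext h y; exact mul_assoc _ _ _
  map_zero' := by ext h y; exact zero_mul _
  map_add' f g := by ext h y; exact add_mul _ _ _
  commutes' c := by ext h y; rfl
  map_star' g := by
    rw [ContinuousLinearMap.star_eq_adjoint, ContinuousLinearMap.eq_adjoint_iff]
    intro h k
    rw [lp.inner_eq_tsum, lp.inner_eq_tsum]
    refine tsum_congr fun y => ?_
    rw [mulOp_apply, mulOp_apply]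
    simp only [RCLike.inner_apply, ContinuousMap.star_apply, map_mul, RCLike.star_def,
      Complex.conj_conj]
    ring

end SquareSummable

/-! ### The orbit representation. -/

section OrbitRep

open scoped InnerProductSpace

variable {X : Type u} [TopologicalSpace X] {n : ℕ} (σ : Fin n → C(X, X))

/-- The index set of the orbit representation. -/
abbrev OrbitIndex : Type u := Cover σ × ℤ

/-- The map `(z, m) ↦ (σ̃ᵢ z, m + 1)`. -/
def orbitStep (i : Fin n) (y : OrbitIndex σ) : OrbitIndex σ := (coverMap σ i y.1, y.2 + 1)

theorem orbitStep_injective (i : Fin n) : Function.Injective (orbitStep σ i) := fun y y' h => by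
  obtain ⟨h1, h2⟩ := Prod.ext_iff.mp h
  exact Prod.ext (coverMap_injective i h1) (by simpa [orbitStep] using h2)

/-- The isometries of the orbit representation. -/
def orbitGen (i : Fin n) : L2 (OrbitIndex σ) →L[ℂ] L2 (OrbitIndex σ) :=
  (basisIsometry (orbitStep_injective σ i)).toContinuousLinearMap

@[simp] theorem orbitGen_basisVec (i : Fin n) (y : OrbitIndex σ) :
    orbitGen σ i (basisVec y) = basisVec (orbitStep σ i y) :=
  basisIsometry_basisVec (orbitStep_injective σ i) y

theorem orbitGen_star_mul (i k : Fin n) :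
    star (orbitGen σ i) * orbitGen σ k = if i = k then 1 else 0 := by
  classical
  refine clm_ext_basisVec fun y => ?_
  ext z
  rw [← inner_basisVec_left, ContinuousLinearMap.star_eq_adjoint, mul_apply_eq_comp,
    ContinuousLinearMap.adjoint_inner_right, orbitGen_basisVec, orbitGen_basisVec,
    inner_basisVec_left, basisVec_apply]
  have : orbitStep σ i z = orbitStep σ k y ↔ i = k ∧ z = y := by
    constructor
    · intro h
      have h1 : i = k := congrArg (fun q : OrbitIndex σ => firstIndex q.1) h
      subst h1
      exact ⟨rfl, orbitStep_injective σ i h⟩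
    · rintro ⟨rfl, rfl⟩; rfl
  by_cases h : i = k
  · by_cases hzy : z = y
    · rw [if_pos (this.mpr ⟨h, hzy⟩), if_pos h, one_apply_eq_self, basisVec_apply, if_pos hzy]
    · rw [if_neg fun e => hzy (this.mp e).2, if_pos h, one_apply_eq_self, basisVec_apply,
        if_neg hzy]
  · rw [if_neg fun e => h (this.mp e).1, if_neg h]
    rfl

theorem sum_orbitGen_mul_star : ∑ i, orbitGen σ i * star (orbitGen σ i) = 1 := by
  refine clm_ext_basisVec fun y => ?_
  -- Every index has a predecessor under one of the steps. This is why the second coordinate runs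
  -- over `ℤ` and not over `ℕ`, where vectors at height `0` would be missed.
  have hy : basisVec y = orbitGen σ (firstIndex y.1) (basisVec (shift σ y.1, y.2 - 1)) := by
    rw [orbitGen_basisVec, orbitStep, coverMap_firstIndex, sub_add_cancel]
  have : (∑ i, orbitGen σ i * star (orbitGen σ i)) * orbitGen σ (firstIndex y.1) =
      orbitGen σ (firstIndex y.1) := by
    rw [Finset.sum_mul, Finset.sum_eq_single (firstIndex y.1)]
    · rw [mul_assoc, orbitGen_star_mul, if_pos rfl, mul_one]
    · intro i _ hi
      rw [mul_assoc, orbitGen_star_mul, if_neg hi, mul_zero]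
    · simp
  rw [hy, ← mul_apply_eq_comp, this]
  rfl

/-- Composition with the projection, as a `*`-homomorphism `C(X) → C(X̃)`. -/
def pullback : C(X, ℂ) →⋆ₐ[ℂ] C(Cover σ, ℂ) :=
  ContinuousMap.compStarAlgHom' ℂ ℂ (coverProj σ)

variable [CompactSpace X] [T2Space X]

/-- Multiplication by functions on the covering space. -/
def orbitMul : C(Cover σ, ℂ) →⋆ₐ[ℂ] (L2 (OrbitIndex σ) →L[ℂ] L2 (OrbitIndex σ)) :=
  mulHom fun y : OrbitIndex σ => y.1

@[simp] theorem orbitMul_basisVec (g : C(Cover σ, ℂ)) (y : OrbitIndex σ) :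
    orbitMul σ g (basisVec y) = g y.1 • basisVec y :=
  mulOp_basisVec (fun y : OrbitIndex σ => y.1) g y

theorem orbitMul_mul_orbitGen (g : C(Cover σ, ℂ)) (i : Fin n) :
    orbitMul σ g * orbitGen σ i = orbitGen σ i * orbitMul σ (g.comp (coverMap σ i)) := by
  refine clm_ext_basisVec fun y => ?_
  rw [mul_apply_eq_comp, mul_apply_eq_comp, orbitGen_basisVec, orbitMul_basisVec,
    orbitMul_basisVec, map_smul, orbitGen_basisVec]
  rfl

/-- The orbit representation of the covariance algebra. -/
def orbitRep : CovAlg σ →ₐ[ℂ] (L2 (OrbitIndex σ) →L[ℂ] L2 (OrbitIndex σ)) :=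
  mkRep ((orbitMul σ).comp (pullback σ)).toAlgHom (orbitGen σ) fun f i =>
    orbitMul_mul_orbitGen σ (f.comp (coverProj σ)) i

@[simp] theorem orbitRep_coeff (f : C(X, ℂ)) :
    orbitRep σ (coeff σ f) = orbitMul σ (f.comp (coverProj σ)) := mkRep_coeff _ _ _ f

@[simp] theorem orbitRep_gen (i : Fin n) : orbitRep σ (gen σ i) = orbitGen σ i :=
  mkRep_gen _ _ _ i

theorem isRowContractive_orbitRep : IsRowContractive σ (orbitRep σ) := by
  refine ⟨fun f => ?_, fun h => ?_⟩
  · rw [orbitRep_coeff, orbitRep_coeff, ← map_star]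
    rfl
  · refine le_of_eq ?_
    have : ∀ v w : Fin n → L2 (OrbitIndex σ), ⟪∑ i, orbitGen σ i (v i), ∑ i, orbitGen σ i (w i)⟫_ℂ
        = ∑ i, ⟪v i, w i⟫_ℂ := fun v w => by
      rw [sum_inner]
      refine Finset.sum_congr rfl fun i _ => ?_
      rw [inner_sum, Finset.sum_eq_single i]
      · rw [← ContinuousLinearMap.adjoint_inner_right, ← ContinuousLinearMap.star_eq_adjoint,
          ← mul_apply_eq_comp, orbitGen_star_mul, if_pos rfl]
        rfl
      · intro k _ hk
        rw [← ContinuousLinearMap.adjoint_inner_right, ← ContinuousLinearMap.star_eq_adjoint,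
          ← mul_apply_eq_comp, orbitGen_star_mul, if_neg hk.symm]
        simp
      · simp
    have h2 := this h h
    simp only [inner_self_eq_norm_sq_to_K] at h2
    simp only [orbitRep_gen]
    exact_mod_cast h2

theorem orbitRep_genWord_basisVec (w : List (Fin n)) (y : OrbitIndex σ) :
    orbitRep σ (genWord σ w) (basisVec y) = basisVec (coverWord σ w y.1, y.2 + w.length) := by
  induction w with
  | nil => simp
  | cons i w ih =>
    rw [genWord_cons, map_mul, mul_apply_eq_comp, ih, orbitRep_gen, orbitGen_basisVec, orbitStep]
    simp [add_assoc]

end OrbitRep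

/-! ### Products along words and iterated conjugation by a row. -/

section WordProducts

variable {A : Type*} [Ring A] {n : ℕ}

/-- The product `t_w = t_{i₁} ⋯ t_{iₖ}`. -/
def wordProd (t : Fin n → A) (w : List (Fin n)) : A := (w.map t).prod

@[simp] theorem wordProd_nil (t : Fin n → A) : wordProd t [] = 1 := rfl

@[simp] theorem wordProd_cons (t : Fin n → A) (i : Fin n) (w : List (Fin n)) :
    wordProd t (i :: w) = t i * wordProd t w := by simp [wordProd]

theorem wordProd_append (t : Fin n → A) (v w : List (Fin n)) :
    wordProd t (v ++ w) = wordProd t v * wordProd t w := by simp [wordProd]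

/-- The map `b ↦ ∑ tᵢ b tᵢ^*`. -/
def rowConj [StarRing A] (t : Fin n → A) (b : A) : A := ∑ i, t i * b * star (t i)

theorem rowConj_iterate [StarRing A] (t : Fin n → A) (k : ℕ) (b : A) :
    (rowConj t)^[k] b = ∑ w ∈ words n k, wordProd t w * b * star (wordProd t w) := by
  induction k with
  | zero => simp
  | succ k ih =>
    rw [Function.iterate_succ_apply', ih, rowConj, sum_words_succ]
    refine Finset.sum_congr rfl fun i _ => ?_
    rw [Finset.mul_sum, Finset.sum_mul]
    refine Finset.sum_congr rfl fun w _ => ?_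
    simp only [wordProd_cons, star_mul, mul_assoc]

theorem rowConj_sub [StarRing A] (t : Fin n → A) (a b : A) :
    rowConj t (a - b) = rowConj t a - rowConj t b := by
  simp [rowConj, mul_sub, sub_mul]

theorem rowConj_iterate_sub [StarRing A] (t : Fin n → A) (k : ℕ) (a b : A) :
    (rowConj t)^[k] (a - b) = (rowConj t)^[k] a - (rowConj t)^[k] b := by
  induction k generalizing a b with
  | zero => rfl
  | succ k ih => rw [Function.iterate_succ_apply, rowConj_sub, ih]; rfl

end WordProducts

section WordsBelow

variable {n : ℕ}

/-- The words of length less than `M`. -/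
def wordsBelow (n M : ℕ) : Finset (List (Fin n)) := (Finset.range M).biUnion (words n)

@[simp] theorem mem_wordsBelow {M : ℕ} {w : List (Fin n)} : w ∈ wordsBelow n M ↔ w.length < M := by
  simp [wordsBelow]

theorem sum_wordsBelow {R : Type*} [AddCommMonoid R] (M : ℕ) (F : List (Fin n) → R) :
    ∑ w ∈ wordsBelow n M, F w = ∑ k ∈ Finset.range M, ∑ w ∈ words n k, F w := by
  refine Finset.sum_biUnion fun k _ l _ hkl => ?_
  refine Finset.disjoint_left.mpr fun w hw hw' => hkl ?_
  rw [← mem_words.mp hw, ← mem_words.mp hw']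

end WordsBelow

/-! ### The Poisson transform of a row contraction. -/

section Poisson

open scoped InnerProductSpace
open Filter Topology

variable {X : Type u} [TopologicalSpace X] {n : ℕ} {σ : Fin n → C(X, X)}

/-- The matrix entries of a polynomial acting on the Fock space. -/
def fockEntry (σ : Fin n → C(X, X)) (c : List (Fin n) →₀ C(X, ℂ)) (u v : List (Fin n)) : C(X, ℂ) :=
  c.sum fun w f => if u = w ++ v then compWord σ v f else 0

theorem fockEntry_single (w : List (Fin n)) (f : C(X, ℂ)) (u v : List (Fin n)) :
    fockEntry σ (Finsupp.single w f) u v = if u = w ++ v then compWord σ v f else 0 := by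
  refine Finsupp.sum_single_index ?_
  split_ifs
  · ext x; simp [compWord_apply]
  · rfl

theorem fockEntry_zero (u v : List (Fin n)) : fockEntry σ 0 u v = 0 := Finsupp.sum_zero_index

theorem fockEntry_add (c d : List (Fin n) →₀ C(X, ℂ)) (u v : List (Fin n)) :
    fockEntry σ (c + d) u v = fockEntry σ c u v + fockEntry σ d u v := by
  refine Finsupp.sum_add_index' (fun w => ?_) fun w f g => ?_
  · split_ifs
    · ext x; simp [compWord_apply]
    · rfl
  · split_ifs
    · ext x; simp [compWord_apply]
    · simp

section Hilbert

variable {H : Type*} [NormedAddCommGroup H] [InnerProductSpace ℂ H] [CompleteSpace H]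

theorem star_inner_right (S : H →L[ℂ] H) (x y : H) : ⟪x, S y⟫_ℂ = ⟪star S x, y⟫_ℂ := by
  rw [ContinuousLinearMap.star_eq_adjoint, ContinuousLinearMap.adjoint_inner_left]

theorem inner_rowConj_self (T : Fin n → H →L[ℂ] H) (h : H) :
    ⟪h, rowConj T 1 h⟫_ℂ = ((∑ i, ‖star (T i) h‖ ^ 2 : ℝ) : ℂ) := by
  simp only [rowConj, mul_one, sum_apply, inner_sum, mul_apply_eq_comp]
  push_cast
  refine Finset.sum_congr rfl fun i _ => ?_
  rw [star_inner_right]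
  exact inner_self_eq_norm_sq_to_K _

/-- A row contraction satisfies `∑ Tᵢ Tᵢ^* ≤ 1`. -/
theorem rowConj_one_le_one {T : Fin n → H →L[ℂ] H}
    (hT : ∀ h : Fin n → H, ‖∑ i, T i (h i)‖ ^ 2 ≤ ∑ i, ‖h i‖ ^ 2) : rowConj T 1 ≤ 1 := by
  have key : ∀ h, ∑ i, ‖star (T i) h‖ ^ 2 ≤ ‖h‖ ^ 2 := by
    intro h
    -- With `Q = ∑ Tᵢ Tᵢ^*` this choice gives `‖Q h‖² ≤ ⟪h, Q h⟫ ≤ ‖h‖ ‖Q h‖`. Hence `‖Q h‖ ≤ ‖h‖`,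
    -- and then `⟪h, Q h⟫ ≤ ‖h‖²`.
    have h1 := hT fun i => star (T i) h
    have h2 := inner_rowConj_self T h
    have h3 : ∑ i, T i (star (T i) h) = rowConj T 1 h := by
      simp [rowConj]
    rw [h3] at h1
    have h4 : ∑ i, ‖star (T i) h‖ ^ 2 ≤ ‖h‖ * ‖rowConj T 1 h‖ := by
      have := norm_inner_le_norm (𝕜 := ℂ) h (rowConj T 1 h)
      rw [h2, Complex.norm_real, Real.norm_of_nonneg (by positivity)] at this
      exact this
    have h5 : ‖rowConj T 1 h‖ ≤ ‖h‖ := by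
      rcases (norm_nonneg (rowConj T 1 h)).eq_or_lt with h0 | h0
      · rw [← h0]; positivity
      · nlinarith
    nlinarith [norm_nonneg h]
  rw [ContinuousLinearMap.le_def, ContinuousLinearMap.isPositive_iff_complex]
  intro h
  have e : ⟪(1 - rowConj T 1) h, h⟫_ℂ = ((‖h‖ ^ 2 - ∑ i, ‖star (T i) h‖ ^ 2 : ℝ) : ℂ) := by
    rw [sub_apply, inner_sub_left, one_apply_eq_self, ← inner_conj_symm (rowConj T 1 h),
      inner_rowConj_self, Complex.conj_ofReal, inner_self_eq_norm_sq_to_K]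
    push_cast
    rfl
  rw [e]
  exact ⟨rfl, sub_nonneg.mpr (key h)⟩

theorem rowConj_iterate_one_nonneg (T : Fin n → H →L[ℂ] H) (k : ℕ) :
    0 ≤ (rowConj T)^[k] 1 := by
  rw [rowConj_iterate]
  exact Finset.sum_nonneg fun w _ => star_right_conjugate_nonneg zero_le_one _

/-- `rowConj T` is order preserving, so each application costs one factor `s`. For `s < 1` the
remainder in `sum_wordsBelow_defect` tends to zero. -/
theorem norm_rowConj_iterate_one_le {T : Fin n → H →L[ℂ] H} {s : ℝ} (hs : 0 ≤ s)
    (hT : rowConj T 1 ≤ s • 1) (k : ℕ) : ‖(rowConj T)^[k] 1‖ ≤ s ^ k := by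
  have h : (rowConj T)^[k] 1 ≤ s ^ k • 1 := by
    induction k with
    | zero => simp
    | succ k ih =>
      rw [Function.iterate_succ_apply']
      have h1 : rowConj T ((rowConj T)^[k] 1) ≤ rowConj T (s ^ k • 1) :=
        Finset.sum_le_sum fun i _ => star_right_conjugate_le_conjugate ih _
      have h2 : rowConj T (s ^ k • 1) = s ^ k • rowConj T 1 := by
        simp [rowConj, Finset.smul_sum]
      rw [h2] at h1
      refine h1.trans ?_
      rw [pow_succ, mul_smul]
      exact smul_le_smul_of_nonneg_left hT (by positivity)
  rw [CStarAlgebra.norm_le_iff_le_algebraMap _ (by positivity) (rowConj_iterate_one_nonneg T k)]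
  rwa [Algebra.algebraMap_eq_smul_one]

theorem mul_wordProd {φ : C(X, ℂ) →⋆ₐ[ℂ] (H →L[ℂ] H)} {T : Fin n → H →L[ℂ] H}
    (hφ : ∀ f i, φ f * T i = T i * φ (f.comp (σ i))) (f : C(X, ℂ)) (w : List (Fin n)) :
    φ f * wordProd T w = wordProd T w * φ (compWord σ w f) := by
  induction w generalizing f with
  | nil => simp [compWord]
  | cons i w ih => rw [wordProd_cons, ← mul_assoc, hφ, mul_assoc, ih, ← mul_assoc, compWord]

/-- The defect operator of a row contraction. -/
def defect (T : Fin n → H →L[ℂ] H) : H →L[ℂ] H := CFC.sqrt (1 - rowConj T 1)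

theorem star_defect (T : Fin n → H →L[ℂ] H) : star (defect T) = defect T :=
  (CFC.sqrt_nonneg _).isSelfAdjoint

theorem defect_mul_defect {T : Fin n → H →L[ℂ] H} (hT : rowConj T 1 ≤ 1) :
    defect T * defect T = 1 - rowConj T 1 :=
  CFC.sqrt_mul_sqrt_self _ (sub_nonneg.mpr hT)

/-- The covariance relation and its adjoint make `φ f` commute with each `Tᵢ Tᵢ^*`, hence with any
continuous function of their sum. -/
theorem commute_defect {φ : C(X, ℂ) →⋆ₐ[ℂ] (H →L[ℂ] H)} {T : Fin n → H →L[ℂ] H}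
    (hφ : ∀ f i, φ f * T i = T i * φ (f.comp (σ i))) (f : C(X, ℂ)) :
    Commute (defect T) (φ f) := by
  have h : Commute (rowConj T 1) (φ f) := by
    rw [commute_iff_eq, rowConj, Finset.sum_mul, Finset.mul_sum]
    refine Finset.sum_congr rfl fun i _ => ?_
    have := congrArg star (hφ (star f) i)
    rw [star_mul, star_mul, ← map_star, ← map_star, star_star] at this
    have e : star ((star f).comp (σ i)) = f.comp (σ i) := by ext x; simp
    rw [e] at this
    rw [mul_one, mul_assoc, this, ← mul_assoc, ← mul_assoc, hφ]
  rw [defect, CFC.sqrt_eq_cfc]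
  exact (((Commute.one_left _).sub_left h).cfc_nnreal _)

/-- The components of the Poisson transform of a vector. -/
def poisson (T : Fin n → H →L[ℂ] H) (w : List (Fin n)) (ξ : H) : H :=
  defect T (star (wordProd T w) ξ)

/-- With `R = rowConj T` and `D² = 1 - R 1`, the words of length `k` contribute `R^k 1 - R^(k+1) 1`,
and the sum over `k < M` telescopes. -/
theorem sum_wordsBelow_defect {T : Fin n → H →L[ℂ] H} (hT : rowConj T 1 ≤ 1) (M : ℕ) :
    ∑ w ∈ wordsBelow n M, wordProd T w * (defect T * defect T) * star (wordProd T w) =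
      1 - (rowConj T)^[M] 1 := by
  rw [sum_wordsBelow]
  have : ∀ k, ∑ w ∈ words n k, wordProd T w * (defect T * defect T) * star (wordProd T w) =
      (rowConj T)^[k] 1 - (rowConj T)^[k + 1] 1 := fun k => by
    rw [← rowConj_iterate, defect_mul_defect hT, rowConj_iterate_sub]
    rfl
  simp only [this]
  rw [Finset.sum_range_sub']
  rfl

/-- The left side is `⟪ξ, (1 - R^M 1) ξ⟫` with `R = rowConj T`, and `R^M 1` is positive. So
truncated Poisson transforms are contractive. -/
theorem sum_norm_poisson_sq_le {T : Fin n → H →L[ℂ] H} (hT : rowConj T 1 ≤ 1) (M : ℕ) (ξ : H) :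
    ∑ w ∈ wordsBelow n M, ‖poisson T w ξ‖ ^ 2 ≤ ‖ξ‖ ^ 2 := by
  have h1 : ((∑ w ∈ wordsBelow n M, ‖poisson T w ξ‖ ^ 2 : ℝ) : ℂ) =
      ⟪ξ, (1 - (rowConj T)^[M] 1) ξ⟫_ℂ := by
    rw [← sum_wordsBelow_defect hT, sum_apply, inner_sum]
    push_cast
    refine Finset.sum_congr rfl fun w _ => ?_
    have := inner_self_eq_norm_sq_to_K (𝕜 := ℂ) (poisson T w ξ)
    refine this.symm.trans ?_
    change ⟪poisson T w ξ, poisson T w ξ⟫_ℂ =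
      ⟪ξ, wordProd T w (defect T (poisson T w ξ))⟫_ℂ
    refine Eq.symm ((star_inner_right (wordProd T w) _ _).trans
      ((star_inner_right (defect T) _ _).trans ?_))
    rw [star_defect]
    rfl
  have h2 : 0 ≤ RCLike.re ⟪ξ, (rowConj T)^[M] 1 ξ⟫_ℂ :=
    ((ContinuousLinearMap.nonneg_iff_isPositive _).mp
      (rowConj_iterate_one_nonneg T M)).re_inner_nonneg_right ξ
  have h3 := congrArg RCLike.re h1
  rw [sub_apply, inner_sub_right, map_sub, one_apply_eq_self, inner_self_eq_norm_sq] at h3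
  change ∑ w ∈ wordsBelow n M, ‖poisson T w ξ‖ ^ 2 = _ at h3
  linarith

theorem inner_poisson {φ : C(X, ℂ) →⋆ₐ[ℂ] (H →L[ℂ] H)} {T : Fin n → H →L[ℂ] H}
    (hφ : ∀ f i, φ f * T i = T i * φ (f.comp (σ i)))
    (w v : List (Fin n)) (f : C(X, ℂ)) (ξ η : H) :
    ⟪poisson T (w ++ v) ξ, φ (compWord σ v f) (poisson T v η)⟫_ℂ =
      ⟪ξ, (wordProd T w * φ f *
        (wordProd T v * (defect T * defect T) * star (wordProd T v))) η⟫_ℂ := by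
  have e : wordProd T w * φ f * (wordProd T v * (defect T * defect T) * star (wordProd T v)) =
      wordProd T (w ++ v) * (defect T * (φ (compWord σ v f) *
        (defect T * star (wordProd T v)))) := by
    have h1 := mul_wordProd hφ f v
    have h2 := (commute_defect hφ (compWord σ v f)).eq
    calc _ = wordProd T w * (φ f * wordProd T v) * defect T * defect T *
          star (wordProd T v) := by simp only [mul_assoc]
      _ = wordProd T w * wordProd T v * (φ (compWord σ v f) * defect T) * defect T *
          star (wordProd T v) := by rw [h1]; simp only [mul_assoc]
      _ = _ := by rw [← h2, wordProd_append]; simp only [mul_assoc]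
  rw [e]
  simp only [mul_apply_eq_comp, poisson]
  rw [star_inner_right (wordProd T (w ++ v)), star_inner_right (defect T), star_defect]

/-- In the limit the Poisson transform is an isometry that dilates the representation to the Fock
matrices. For a monomial `s_w f` only the pairs `u = w v` contribute. With both words shorter than
`M`, the sum is `⟪ξ, T_w φ(f) (1 - R^(M-|w|) 1) η⟫` for `R = rowConj T`. -/
theorem tendsto_sum_inner_poisson {φ : C(X, ℂ) →⋆ₐ[ℂ] (H →L[ℂ] H)} {T : Fin n → H →L[ℂ] H}
    {s : ℝ} (hs : 0 ≤ s) (hs1 : s < 1) (hT : rowConj T 1 ≤ s • 1) (hT1 : rowConj T 1 ≤ 1)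
    (hφ : ∀ f i, φ f * T i = T i * φ (f.comp (σ i)))
    (c : List (Fin n) →₀ C(X, ℂ)) (ξ η : H) :
    Tendsto (fun M => ∑ u ∈ wordsBelow n M, ∑ v ∈ wordsBelow n M,
      ⟪poisson T u ξ, φ (fockEntry σ c u v) (poisson T v η)⟫_ℂ) atTop
      (𝓝 ⟪ξ, (c.sum fun w f => wordProd T w * φ f) η⟫_ℂ) := by
  induction c using Finsupp.induction_linear with
  | zero => simp [fockEntry_zero]
  | add c d hc hd =>
    rw [Finsupp.sum_add_index' (by simp) (by simp [mul_add]), add_apply, inner_add_right]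
    refine (hc.add hd).congr fun M => ?_
    simp [fockEntry_add, Finset.sum_add_distrib]
  | single w f =>
    rw [Finsupp.sum_single_index (by simp)]
    have h0 : Tendsto (fun k => (rowConj T)^[k] 1) atTop (𝓝 0) :=
      squeeze_zero_norm (fun k => norm_rowConj_iterate_one_le hs hT k)
        (tendsto_pow_atTop_nhds_zero_of_lt_one hs hs1)
    have h1 : Tendsto (fun M => ⟪ξ, (wordProd T w * φ f *
        (1 - (rowConj T)^[M - w.length] 1)) η⟫_ℂ) atTop
        (𝓝 ⟪ξ, (wordProd T w * φ f * (1 - 0)) η⟫_ℂ) := by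
      have h2 := h0.comp (tendsto_sub_atTop_nat w.length)
      have hc : Continuous fun S : H →L[ℂ] H =>
          ⟪ξ, (wordProd T w * φ f * (1 - S)) η⟫_ℂ :=
        continuous_const.inner (Continuous.clm_apply
          (by fun_prop : Continuous fun S : H →L[ℂ] H => wordProd T w * φ f * (1 - S))
          continuous_const)
      exact (hc.tendsto 0).comp h2
    rw [sub_zero, mul_one] at h1
    -- For `M < |w|` the truncated subtraction gives `R^0 1 = 1` and no words, so both sides vanish.
    refine h1.congr fun M => ?_
    rw [← sum_wordsBelow_defect hT1, Finset.mul_sum, sum_apply, inner_sum, Finset.sum_comm]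
    symm
    have hsub : wordsBelow n (M - w.length) ⊆ wordsBelow n M := fun v hv => by
      rw [mem_wordsBelow] at hv ⊢; omega
    rw [← Finset.sum_subset hsub]
    · refine Finset.sum_congr rfl fun v hv => ?_
      rw [Finset.sum_eq_single (w ++ v)]
      · rw [fockEntry_single, if_pos rfl, inner_poisson hφ]
      · intro u _ hu
        rw [fockEntry_single, if_neg hu]
        simp
      · intro h
        rw [mem_wordsBelow] at hv h
        exact absurd (by rw [List.length_append]; omega) h
    · intro v _ hv
      refine Finset.sum_eq_zero fun u hu => ?_
      rw [fockEntry_single, if_neg]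
      · simp
      · rintro rfl
        rw [mem_wordsBelow, List.length_append] at hu
        rw [mem_wordsBelow] at hv
        omega

end Hilbert

end Poisson

/-! ### Domination of row contractive representations by the orbit representation. -/

section CompleteIsometry

open scoped InnerProductSpace
open Filter Topology

variable {X : Type u} [TopologicalSpace X] [CompactSpace X] [T2Space X] {n : ℕ}
  {σ : Fin n → C(X, X)}

/-- The basis vector of the orbit representation at `σ̃_v z`. -/
def orbitVec (z : Cover σ) (v : List (Fin n)) : L2 (OrbitIndex σ) :=
  basisVec (coverWord σ v z, (v.length : ℤ))

-- The integer coordinate separates words of different lengths. Words of equal length are separated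
-- by the indices of `σ̃_v z`.
omit [CompactSpace X] [T2Space X] in
theorem orthonormal_orbitVec (z : Cover σ) : Orthonormal ℂ (orbitVec z) := by
  refine orthonormal_basisVec.comp (fun v : List (Fin n) =>
    ((coverWord σ v z, (v.length : ℤ)) : OrbitIndex σ)) fun u v h => ?_
  obtain ⟨h1, h2⟩ := Prod.ext_iff.mp h
  have h3 : (u.length : ℤ) = v.length := h2
  exact (coverWord_inj_of_length (by exact_mod_cast h3) h1).1

/-- This links the two pictures: the Fock matrix evaluated at `p(z)` is the compression of the orbit
representation to the vectors over the forward orbit of `z`. -/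
theorem inner_orbitRep_poly (z : Cover σ) (c : List (Fin n) →₀ C(X, ℂ)) (u v : List (Fin n)) :
    ⟪orbitVec z u, orbitRep σ (poly c) (orbitVec z v)⟫_ℂ = fockEntry σ c u v (coverProj σ z) := by
  induction c using Finsupp.induction_linear with
  | zero => simp [fockEntry_zero, poly]
  | add c d hc hd =>
    rw [poly_add, map_add, add_apply, inner_add_right, hc, hd, fockEntry_add]
    rfl
  | single w f =>
    rw [poly_single, map_mul, mul_apply_eq_comp, orbitRep_coeff]
    have h1 : orbitMul σ (f.comp (coverProj σ)) (orbitVec z v) =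
        f (wordMap σ v (coverProj σ z)) • orbitVec z v := by
      rw [orbitVec, orbitMul_basisVec, ← coverProj_coverWord]
      rfl
    have h2 : orbitRep σ (genWord σ w) (orbitVec z v) = orbitVec z (w ++ v) := by
      rw [orbitVec, orbitRep_genWord_basisVec, orbitVec, coverWord_append, List.length_append]
      push_cast
      rw [add_comm]
    rw [h1, map_smul, h2, inner_smul_right, fockEntry_single,
      orthonormal_iff_ite.mp (orthonormal_orbitVec z)]
    split_ifs
    · rw [mul_one, compWord_apply]
    · simp

/-- The norm estimate for the Fock space matrices of polynomials with coefficients in `C(X)`. -/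
theorem norm_map_fockMatrix_le (hσ : IsSurjective σ) {B : Type*} [CStarAlgebra B] {m : ℕ}
    (c : Fin m → Fin m → List (Fin n) →₀ C(X, ℂ)) (M : ℕ)
    (ψ : CStarMatrix (wordsBelow n M × Fin m) (wordsBelow n M × Fin m) C(X, ℂ) →⋆ₙₐ[ℂ] B) :
    ‖ψ (CStarMatrix.ofMatrix fun i k => fockEntry σ (c i.2 k.2) i.1 k.1)‖ ≤
      ‖CStarMatrix.ofMatrix (Matrix.of fun k l => orbitRep σ (poly (c k l)))‖ := by
  refine norm_map_le_of_eval_le ψ _ (norm_nonneg _) fun x ξ η => ?_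
  obtain ⟨z, rfl⟩ := coverProj_surjective hσ x
  -- Scalar vectors indexed by words embed isometrically along the orthonormal family `orbitVec z`.
  -- This exhibits the scalar matrix as a compression.
  let vec : EuclideanSpace ℂ (wordsBelow n M × Fin m) →
      PiLp 2 (fun _ : Fin m => L2 (OrbitIndex σ)) := fun ζ =>
    WithLp.toLp 2 fun k => ∑ v : wordsBelow n M, ζ (v, k) • orbitVec z v
  have hnorm : ∀ ζ, ‖vec ζ‖ = ‖ζ‖ := fun ζ => by
    rw [PiLp.norm_eq_of_L2, EuclideanSpace.norm_eq, Fintype.sum_prod_type, Finset.sum_comm]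
    congr 1
    refine Finset.sum_congr rfl fun k _ => ?_
    have h := ((orthonormal_orbitVec z).comp (Subtype.val : wordsBelow n M → _)
      Subtype.val_injective).inner_sum (fun v => ζ (v, k)) (fun v => ζ (v, k)) Finset.univ
    rw [inner_self_eq_norm_sq_to_K] at h
    simp only [Complex.conj_mul'] at h
    change ‖∑ v : wordsBelow n M, ζ (v, k) • (orbitVec z ∘ Subtype.val) v‖ ^ 2 = _
    apply Complex.ofReal_injective
    push_cast
    exact h
  have := norm_sum_inner_le
    (CStarMatrix.ofMatrix (Matrix.of fun k l => orbitRep σ (poly (c k l)))) (vec ξ) (vec η)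
  rw [hnorm, hnorm] at this
  refine le_of_eq_of_le (congrArg _ ?_) this
  simp only [Fintype.sum_prod_type]
  rw [Finset.sum_comm]
  refine Finset.sum_congr rfl fun k _ => ?_
  have e : ∀ l, ⟪vec ξ k, orbitRep σ (poly (c k l)) (vec η l)⟫_ℂ =
      ∑ u : wordsBelow n M, ∑ v : wordsBelow n M,
        star (ξ (u, k)) * (fockEntry σ (c k l) u v (coverProj σ z) * η (v, l)) := fun l => by
    simp only [vec, map_sum, map_smul]
    rw [sum_inner]
    refine Finset.sum_congr rfl fun u _ => ?_
    rw [inner_smul_left, inner_sum, Finset.mul_sum]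
    refine Finset.sum_congr rfl fun v _ => ?_
    rw [inner_smul_right, inner_orbitRep_poly, mul_comm (η (v, l))]
    rfl
  refine Eq.trans (Finset.sum_congr rfl fun u _ => Finset.sum_comm) ?_
  rw [Finset.sum_comm]
  exact Finset.sum_congr rfl fun l _ => (e l).symm

/-- The estimate of a row contractive representation with `∑ Tᵢ Tᵢ^* ≤ s < 1`. -/
theorem norm_sum_inner_poly_le (hσ : IsSurjective σ) {H : Type*} [NormedAddCommGroup H]
    [InnerProductSpace ℂ H] [CompleteSpace H] {φ : C(X, ℂ) →⋆ₐ[ℂ] (H →L[ℂ] H)}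
    {T : Fin n → H →L[ℂ] H} {s : ℝ} (hs : 0 ≤ s) (hs1 : s < 1) (hT : rowConj T 1 ≤ s • 1)
    (hT1 : rowConj T 1 ≤ 1) (hφ : ∀ f i, φ f * T i = T i * φ (f.comp (σ i))) {m : ℕ}
    (c : Fin m → Fin m → List (Fin n) →₀ C(X, ℂ)) (ξ η : PiLp 2 (fun _ : Fin m => H)) :
    ‖∑ k, ∑ l, ⟪ξ k, ((c k l).sum fun w f => wordProd T w * φ f) (η l)⟫_ℂ‖ ≤
      ‖CStarMatrix.ofMatrix (Matrix.of fun k l => orbitRep σ (poly (c k l)))‖ *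
        (‖ξ‖ * ‖η‖) := by
  have hlim : Tendsto (fun M => ∑ k, ∑ l, ∑ u ∈ wordsBelow n M, ∑ v ∈ wordsBelow n M,
      ⟪poisson T u (ξ k), φ (fockEntry σ (c k l) u v) (poisson T v (η l))⟫_ℂ) atTop
      (𝓝 (∑ k, ∑ l, ⟪ξ k, ((c k l).sum fun w f => wordProd T w * φ f) (η l)⟫_ℂ)) :=
    tendsto_finsetSum _ fun k _ => tendsto_finsetSum _ fun l _ =>
      tendsto_sum_inner_poisson hs hs1 hT hT1 hφ (c k l) (ξ k) (η l)
  refine le_of_tendsto hlim.norm (Eventually.of_forall fun M => ?_)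
  -- For fixed `M` the sum is the form of the truncated Fock matrix, with `φ` applied entrywise, at
  -- contractive images of `ξ` and `η`.
  let vec : PiLp 2 (fun _ : Fin m => H) → PiLp 2 (fun _ : wordsBelow n M × Fin m => H) :=
    fun ζ => WithLp.toLp 2 fun i => poisson T i.1 (ζ i.2)
  have hnorm : ∀ ζ, ‖vec ζ‖ ≤ ‖ζ‖ := fun ζ => by
    rw [PiLp.norm_eq_of_L2, PiLp.norm_eq_of_L2, Fintype.sum_prod_type, Finset.sum_comm]
    refine Real.sqrt_le_sqrt (Finset.sum_le_sum fun k _ => ?_)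
    have := sum_norm_poisson_sq_le hT1 M (ζ k)
    rw [← Finset.sum_coe_sort] at this
    exact this
  have h1 := norm_sum_inner_le (CStarMatrix.mapₙₐ (n := wordsBelow n M × Fin m)
    (φ : C(X, ℂ) →⋆ₙₐ[ℂ] (H →L[ℂ] H)) (CStarMatrix.ofMatrix fun i k =>
      fockEntry σ (c i.2 k.2) i.1 k.1)) (vec ξ) (vec η)
  have h2 := norm_map_fockMatrix_le hσ c M (CStarMatrix.mapₙₐ (n := wordsBelow n M × Fin m)
    (φ : C(X, ℂ) →⋆ₙₐ[ℂ] (H →L[ℂ] H)))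
  have h3 : ‖vec ξ‖ * ‖vec η‖ ≤ ‖ξ‖ * ‖η‖ := by gcongr <;> exact hnorm _
  refine le_trans (le_of_eq (congrArg _ ?_)) (h1.trans (mul_le_mul h2 h3 (by positivity)
    (norm_nonneg _)))
  simp only [Fintype.sum_prod_type]
  conv_rhs => rw [Finset.sum_comm]
  refine Finset.sum_congr rfl fun k _ => ?_
  refine Eq.trans ?_ (Finset.sum_congr rfl fun u _ => Finset.sum_comm)
  rw [Finset.sum_comm (s := (Finset.univ : Finset (wordsBelow n M)))]
  refine Finset.sum_congr rfl fun l _ => ?_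
  rw [← Finset.sum_coe_sort]
  refine Finset.sum_congr rfl fun u _ => ?_
  rw [← Finset.sum_coe_sort]
  rfl

/-- Every row contractive representation is dominated by the orbit representation. -/
theorem norm_map_le_orbitRep (hσ : IsSurjective σ) {H : Type u} [NormedAddCommGroup H]
    [InnerProductSpace ℂ H] [CompleteSpace H] {ρ : CovAlg σ →ₐ[ℂ] (H →L[ℂ] H)}
    (hρ : IsRowContractive σ ρ) {m : ℕ} (a : Matrix (Fin m) (Fin m) (CovAlg σ)) :
    ‖CStarMatrix.ofMatrix (a.map ρ)‖ ≤ ‖CStarMatrix.ofMatrix (a.map (orbitRep σ))‖ := by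
  choose c hc using fun k l => exists_poly (a k l)
  have ha : a = Matrix.of fun k l => poly (c k l) := by
    ext k l
    exact hc k l
  refine norm_le_of_sum_inner_le _ (norm_nonneg _) fun ξ η => ?_
  let φ : C(X, ℂ) →⋆ₐ[ℂ] (H →L[ℂ] H) :=
    { ρ.comp (coeff σ) with map_star' := fun f => hρ.1 f }
  have hφ : ∀ f, φ f = ρ (coeff σ f) := fun f => rfl
  let S : Fin n → H →L[ℂ] H := fun i => ρ (gen σ i)
  have hS1 : rowConj S 1 ≤ 1 := rowConj_one_le_one hρ.2
  have hword : ∀ (r : ℝ) (w : List (Fin n)),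
      wordProd (fun i => r • S i) w = r ^ w.length • ρ (genWord σ w) := by
    intro r w
    induction w with
    | nil => simp
    | cons i w ih =>
      rw [wordProd_cons, ih, genWord_cons, map_mul, smul_mul_smul_comm, List.length_cons, pow_succ']
  -- Scaling the generators by `r` gives `∑ Tᵢ Tᵢ^* ≤ r²`, a strict row contraction. The covariance
  -- relation survives because it is linear in `Tᵢ`.
  have key : ∀ r ∈ Set.Ioo (0 : ℝ) 1,
      ‖∑ k, ∑ l, ⟪ξ k, ((c k l).sum fun w f => r ^ w.length • ρ (genWord σ w) * φ f) (η l)⟫_ℂ‖ ≤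
      ‖CStarMatrix.ofMatrix (a.map (orbitRep σ))‖ * (‖ξ‖ * ‖η‖) := by
    intro r hr
    have hT : rowConj (fun i => r • S i) 1 = r ^ 2 • rowConj S 1 := by
      simp only [rowConj, Finset.smul_sum]
      refine Finset.sum_congr rfl fun i _ => ?_
      rw [star_smul, star_trivial, mul_one, mul_one, smul_mul_smul_comm, sq]
    have hTr : rowConj (fun i => r • S i) 1 ≤ r ^ 2 • 1 := by
      rw [hT]
      exact smul_le_smul_of_nonneg_left hS1 (by positivity)
    have hr2 : r ^ 2 < 1 := by nlinarith [hr.1, hr.2]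
    have hT1 : rowConj (fun i => r • S i) 1 ≤ 1 := by
      refine hTr.trans ?_
      calc r ^ 2 • (1 : H →L[ℂ] H) ≤ (1 : ℝ) • (1 : H →L[ℂ] H) :=
            smul_le_smul_of_nonneg_right hr2.le zero_le_one
        _ = 1 := one_smul _ _
    have := norm_sum_inner_poly_le (φ := φ) (T := fun i => r • S i) hσ (by positivity) hr2 hTr hT1
      (fun f i => by
        rw [mul_smul_comm, smul_mul_assoc, hφ, hφ]
        simp only [S]
        rw [← map_mul, coeff_mul_gen, map_mul]) c ξ η
    simp only [hword] at this
    rw [ha]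
    exact this
  have hcont : Continuous fun r : ℝ => ∑ k, ∑ l,
      ⟪ξ k, ((c k l).sum fun w f => r ^ w.length • ρ (genWord σ w) * φ f) (η l)⟫_ℂ := by
    refine continuous_finsetSum _ fun k _ => continuous_finsetSum _ fun l _ =>
      continuous_const.inner (Continuous.clm_apply ?_ continuous_const)
    refine continuous_finsetSum _ fun w _ => ?_
    exact ((continuous_pow _).smul continuous_const).mul continuous_const
  -- The bound does not depend on `r` and a polynomial is a finite sum, so `r → 1` from below
  -- recovers the original representation.
  have hlim := (hcont.tendsto 1).mono_left (nhdsWithin_le_nhds (s := Set.Iio 1))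
  refine le_of_eq_of_le (congrArg _ ?_) (le_of_tendsto hlim.norm
    (mem_of_superset (Ioo_mem_nhdsLT zero_lt_one) key))
  refine Finset.sum_congr rfl fun k _ => Finset.sum_congr rfl fun l _ => ?_
  change ⟪ξ k, ρ (a k l) (η l)⟫_ℂ = _
  rw [hc k l, poly, map_finsuppSum]
  simp only [one_pow, one_smul, map_mul]
  rfl

end CompleteIsometry

theorem continuous_starAlgHom {A B : Type*} [CStarAlgebra A] [CStarAlgebra B] (f : A →⋆ₐ[ℂ] B) :
    Continuous f :=
  AddMonoidHomClass.continuous_of_bound f 1 fun a => by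
    rw [one_mul]; exact NonUnitalStarAlgHom.norm_apply_le f a

/-! ### The orbit algebra as a C*-cover. -/

section OrbitAlgebra

variable {X : Type u} [TopologicalSpace X] [CompactSpace X] [T2Space X] {n : ℕ}
  (σ : Fin n → C(X, X))

/-- The C*-algebra generated by the orbit representation. -/
def orbitAlg : StarSubalgebra ℂ (L2 (OrbitIndex σ) →L[ℂ] L2 (OrbitIndex σ)) :=
  (StarAlgebra.adjoin ℂ (Set.range (orbitRep σ))).topologicalClosure

instance isClosed_orbitAlg :
    IsClosed (orbitAlg σ : Set (L2 (OrbitIndex σ) →L[ℂ] L2 (OrbitIndex σ))) :=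
  StarSubalgebra.isClosed_topologicalClosure _

theorem orbitRep_mem_orbitAlg (a : CovAlg σ) : orbitRep σ a ∈ orbitAlg σ :=
  StarSubalgebra.le_topologicalClosure _ (StarAlgebra.subset_adjoin ℂ _ ⟨a, rfl⟩)

/-- The orbit representation as a homomorphism into the C*-algebra that it generates. -/
def orbitHom : CovAlg σ →ₐ[ℂ] orbitAlg σ :=
  (orbitRep σ).codRestrict (orbitAlg σ).toSubalgebra (orbitRep_mem_orbitAlg σ)

@[simp] theorem coe_orbitHom (a : CovAlg σ) : (orbitHom σ a : L2 (OrbitIndex σ) →L[ℂ] _) =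
    orbitRep σ a := rfl

instance : PartialOrder (orbitAlg σ) := CStarAlgebra.spectralOrder _

instance : StarOrderedRing (orbitAlg σ) := CStarAlgebra.spectralOrderedRing _

variable {σ}

theorem norm_map_orbitHom {m : ℕ} (a : Matrix (Fin m) (Fin m) (CovAlg σ)) :
    ‖CStarMatrix.ofMatrix (a.map (orbitHom σ))‖ = ‖CStarMatrix.ofMatrix (a.map (orbitRep σ))‖ := by
  have hinj : Function.Injective (CStarMatrix.mapₙₐ (n := Fin m)
      ((orbitAlg σ).subtype : orbitAlg σ →⋆ₙₐ[ℂ] (L2 (OrbitIndex σ) →L[ℂ] L2 (OrbitIndex σ)))) := by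
    intro M N h
    ext i k : 2
    exact congrFun (congrFun h i) k
  rw [← NonUnitalStarAlgHom.norm_map _ hinj]
  rfl

theorem isCStarCover_orbitHom (hσ : IsSurjective σ) : IsCStarCover σ (orbitHom σ) where
  isometric m a := by
    rw [norm_map_orbitHom]
    symm
    refine IsGreatest.csSup_eq ⟨⟨_, _, _, _, orbitRep σ, isRowContractive_orbitRep σ, rfl⟩, ?_⟩
    rintro r ⟨H, _, _, _, ρ, hρ, rfl⟩
    exact norm_map_le_orbitRep hσ hρ a
  generates := by
    rw [eq_top_iff]
    rintro ⟨d, hd⟩ -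
    have h1 : (StarAlgebra.adjoin ℂ (Set.range (orbitHom σ))).map (orbitAlg σ).subtype =
        StarAlgebra.adjoin ℂ (Set.range (orbitRep σ)) := by
      rw [StarAlgHom.map_adjoin, ← Set.range_comp]
      rfl
    change (⟨d, hd⟩ : orbitAlg σ) ∈
      closure (StarAlgebra.adjoin ℂ (Set.range (orbitHom σ)) : Set (orbitAlg σ))
    rw [closure_subtype]
    have h2 : d ∈ closure (StarAlgebra.adjoin ℂ (Set.range (orbitRep σ)) : Set _) := hd
    rw [← h1] at h2
    exact h2

/-- The functions acting inside the algebra form a closed `*`-subalgebra to which Stone–Weierstrass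
applies. The indicator of a first index acts as `Sᵢ Sᵢ^*`, and composition with the shift becomes `∑
Sᵢ g Sᵢ^*`. -/
theorem orbitMul_mem_orbitAlg (g : C(Cover σ, ℂ)) : orbitMul σ g ∈ orbitAlg σ := by
  have hS : ∀ i, orbitGen σ i ∈ orbitAlg σ := fun i => by
    have := orbitRep_mem_orbitAlg σ (gen σ i)
    rwa [orbitRep_gen] at this
  have hexp : ∀ g, orbitMul σ g = ∑ i, orbitGen σ i * orbitMul σ (g.comp (coverMap σ i)) *
      star (orbitGen σ i) := fun g => by
    simp only [← orbitMul_mul_orbitGen, mul_assoc]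
    rw [← Finset.mul_sum, sum_orbitGen_mul_star, mul_one]
  have htop := starSubalgebra_cover_eq_top ((orbitAlg σ).comap (orbitMul σ))
    ((isClosed_orbitAlg σ).preimage (continuous_starAlgHom (orbitMul σ))) ?_ ?_ ?_
  · have : g ∈ (orbitAlg σ).comap (orbitMul σ) := by rw [htop]; trivial
    exact this
  · intro f
    have := orbitRep_mem_orbitAlg σ (coeff σ f)
    rwa [orbitRep_coeff] at this
  · intro i
    change orbitMul σ (indexIndicator σ i) ∈ orbitAlg σ
    rw [hexp]
    refine sum_mem fun k _ => mul_mem (mul_mem (hS k) ?_) (star_mem (hS k))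
    rw [indexIndicator_comp_coverMap]
    split_ifs
    · rw [map_one]; exact one_mem _
    · rw [map_zero]; exact zero_mem _
  · intro g hg
    change orbitMul σ (g.comp (shift σ)) ∈ orbitAlg σ
    rw [hexp]
    exact sum_mem fun k _ => mul_mem (mul_mem (hS k) hg) (star_mem (hS k))

/-- The multiplication operators inside the C*-algebra of the orbit representation. -/
def orbitMulHom : C(Cover σ, ℂ) →⋆ₐ[ℂ] orbitAlg σ :=
  (orbitMul σ).codRestrict (orbitAlg σ) orbitMul_mem_orbitAlg

end OrbitAlgebra

/-! ### What the C*-envelope inherits from the orbit algebra. -/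

section Envelope

variable {X : Type u} [TopologicalSpace X] [CompactSpace X] [T2Space X] {n : ℕ}
  {σ : Fin n → C(X, X)} {E : Type u} [CStarAlgebra E] [PartialOrder E] [StarOrderedRing E]
  {j : CovAlg σ →ₐ[ℂ] E}

/-- The generators of the C*-envelope satisfy the Cuntz relations, and `C(X̃)` acts. -/
theorem IsCStarEnvelope.relations (hσ : IsSurjective σ) (hj : IsCStarEnvelope σ j) :
    (∀ i k, star (j (gen σ i)) * j (gen σ k) = if i = k then 1 else 0) ∧
      ∑ i, j (gen σ i) * star (j (gen σ i)) = 1 ∧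
      ∃ π : C(Cover σ, ℂ) →⋆ₐ[ℂ] E, IsCoverExtension σ j π := by
  -- All the relations hold in the orbit algebra and are carried over by the quotient map `q`, which
  -- intertwines `orbitHom σ` with `j`.
  obtain ⟨q, -, hq⟩ := hj.minimal (orbitAlg σ) (orbitHom σ) (isCStarCover_orbitHom hσ)
  refine ⟨fun i k => ?_, ?_, q.comp orbitMulHom, ⟨fun f => ?_, fun g i => ?_⟩⟩
  · have h : star (orbitHom σ (gen σ i)) * orbitHom σ (gen σ k) = if i = k then 1 else 0 := by
      refine Subtype.ext ?_
      have := orbitGen_star_mul σ i k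
      simp only [← orbitRep_gen] at this
      refine this.trans ?_
      split_ifs <;> rfl
    rw [← hq, ← hq, ← map_star, ← map_mul, h]
    split_ifs <;> simp
  · have h : ∑ i, orbitHom σ (gen σ i) * star (orbitHom σ (gen σ i)) = 1 := by
      refine Subtype.ext ?_
      have := sum_orbitGen_mul_star σ
      simp only [← orbitRep_gen] at this
      refine Eq.trans ?_ this
      rw [AddSubmonoidClass.coe_finsetSum]
      rfl
    simp only [← hq, ← map_star, ← map_mul, ← map_sum]
    rw [h, map_one]
  · have h : orbitMulHom (f.comp (coverProj σ)) = orbitHom σ (coeff σ f) :=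
      Subtype.ext (orbitRep_coeff σ f).symm
    rw [StarAlgHom.comp_apply, h, hq]
  · have h : orbitMulHom g * orbitHom σ (gen σ i) =
        orbitHom σ (gen σ i) * orbitMulHom (g.comp (coverMap σ i)) := by
      refine Subtype.ext ?_
      have := orbitMul_mul_orbitGen σ g i
      simp only [← orbitRep_gen] at this
      exact this
    rw [StarAlgHom.comp_apply, StarAlgHom.comp_apply, ← hq, ← map_mul, ← map_mul, h]

/-- `C(X)` embeds into the C*-envelope. -/
theorem IsCStarEnvelope.coeff_eq_zero (hσ : IsSurjective σ) (hj : IsCStarEnvelope σ j)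
    {f : C(X, ℂ)} (hf : j (coeff σ f) = 0) : f = 0 := by
  -- Both `j` and the orbit representation realize the same tensor norm. So `f` also acts as zero on
  -- `ℓ²(X̃ × ℤ)`, where it is visibly zero at every `p(z)`.
  have h1 := hj.isometric 1 (Matrix.of fun _ _ => coeff σ f)
  have h2 := (isCStarCover_orbitHom hσ).isometric 1 (Matrix.of fun _ _ => coeff σ f)
  have h3 : CStarMatrix.ofMatrix ((Matrix.of fun _ _ : Fin 1 => coeff σ f).map j) = 0 := by
    ext i k
    exact hf
  rw [h3, norm_zero] at h1
  rw [← h1, norm_eq_zero] at h2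
  have h4 : orbitHom σ (coeff σ f) = 0 := congrFun (congrFun h2 0) 0
  have h5 : orbitMul σ (f.comp (coverProj σ)) = 0 := by
    rw [← orbitRep_coeff]
    exact congrArg Subtype.val h4
  ext x
  obtain ⟨z, rfl⟩ := coverProj_surjective hσ x
  have h6 := congrArg (fun T => T (basisVec (z, (0 : ℤ))) (z, (0 : ℤ))) h5
  simpa [basisVec_apply] using h6

end Envelope

/-! ### Consequences of the Cuntz relations. -/

section CuntzRelations

open Filter Topology

variable {X : Type u} [TopologicalSpace X] {n : ℕ} {σ : Fin n → C(X, X)}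
  {E : Type u} [CStarAlgebra E]

/-- A covariant pair of a representation of `C(X̃)` and a Cuntz family. -/
structure IsCuntzPair [CompactSpace X] [T2Space X] (t : Fin n → E)
    (π : C(Cover σ, ℂ) →⋆ₐ[ℂ] E) : Prop where
  orth : ∀ i k, star (t i) * t k = if i = k then 1 else 0
  sum : ∑ i, t i * star (t i) = 1
  cov : ∀ g i, π g * t i = t i * π (g.comp (coverMap σ i))

theorem norm_one_le : ‖(1 : E)‖ ≤ 1 := by
  nontriviality E
  exact CStarRing.norm_one.le

namespace IsCuntzPair

variable [CompactSpace X] [T2Space X] {t : Fin n → E} {π : C(Cover σ, ℂ) →⋆ₐ[ℂ] E}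
  (h : IsCuntzPair t π)

include h

theorem eq_sum (g : C(Cover σ, ℂ)) :
    π g = ∑ i, t i * π (g.comp (coverMap σ i)) * star (t i) := by
  simp only [← h.cov, mul_assoc]
  rw [← Finset.mul_sum, h.sum, mul_one]

theorem map_comp_shift (g : C(Cover σ, ℂ)) : π (g.comp (shift σ)) = rowConj t (π g) := by
  rw [h.eq_sum]
  rfl

theorem map_indexIndicator (i : Fin n) : π (indexIndicator σ i) = t i * star (t i) := by
  rw [h.eq_sum, Finset.sum_eq_single i]
  · rw [indexIndicator_comp_coverMap, if_pos rfl, map_one, mul_one]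
  · intro k _ hk
    rw [indexIndicator_comp_coverMap, if_neg hk, map_zero, mul_zero, zero_mul]
  · simp

theorem star_mul_map_mul (g : C(Cover σ, ℂ)) (i k : Fin n) :
    star (t i) * π g * t k = if i = k then π (g.comp (coverMap σ i)) else 0 := by
  rw [mul_assoc, h.cov, ← mul_assoc, h.orth]
  split_ifs with hik
  · rw [one_mul, hik]
  · rw [zero_mul]

/-- A covariant representation of `C(X̃)` is determined by its restriction to `C(X)`. -/
theorem unique {π' : C(Cover σ, ℂ) →⋆ₐ[ℂ] E} (h' : IsCuntzPair t π')
    (hX : ∀ f : C(X, ℂ), π (f.comp (coverProj σ)) = π' (f.comp (coverProj σ))) : π = π' := by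
  have htop := starSubalgebra_cover_eq_top (StarAlgHom.equalizer π π')
    (isClosed_eq (continuous_starAlgHom π) (continuous_starAlgHom π')) hX
    (fun i => (h.map_indexIndicator i).trans (h'.map_indexIndicator i).symm)
    (fun g hg => (h.map_comp_shift g).trans
      ((congrArg (rowConj t) hg).trans (h'.map_comp_shift g).symm))
  ext g
  have : g ∈ StarAlgHom.equalizer π π' := by rw [htop]; trivial
  exact this

theorem map_mul_word (g : C(Cover σ, ℂ)) (w : List (Fin n)) :
    π g * wordProd t w = wordProd t w * π (g.comp (coverWord σ w)) := by
  induction w generalizing g with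
  | nil => simp [coverWord]
  | cons i w ih => rw [wordProd_cons, ← mul_assoc, h.cov, mul_assoc, ih, ← mul_assoc]; rfl

theorem star_word_mul_map (g : C(Cover σ, ℂ)) (w : List (Fin n)) :
    star (wordProd t w) * π g = π (g.comp (coverWord σ w)) * star (wordProd t w) := by
  have := congrArg star (h.map_mul_word (star g) w)
  rw [star_mul, star_mul, ← map_star, ← map_star, star_star] at this
  have e : star ((star g).comp (coverWord σ w)) = g.comp (coverWord σ w) := by ext z; simp
  rwa [e] at this

theorem star_word_mul_word_of_length {v w : List (Fin n)} (hl : v.length = w.length) :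
    star (wordProd t v) * wordProd t w = if v = w then 1 else 0 := by
  induction v generalizing w with
  | nil =>
    cases w with
    | nil => simp
    | cons => simp at hl
  | cons i v ih =>
    cases w with
    | nil => simp at hl
    | cons k w =>
      rw [wordProd_cons, wordProd_cons, star_mul, mul_assoc, ← mul_assoc (star (t i)), h.orth]
      by_cases hik : i = k
      · rw [if_pos hik, one_mul, ih (by simpa using hl)]
        simp [hik]
      · rw [if_neg hik]
        simp [hik]

theorem star_word_mul_self (w : List (Fin n)) : star (wordProd t w) * wordProd t w = 1 := by
  rw [h.star_word_mul_word_of_length rfl, if_pos rfl]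

/-- Letters cancel from the left until one word is exhausted or two letters disagree. The product
survives only if one word is a prefix of the other. -/
theorem star_word_mul_word (v x : List (Fin n)) :
    (∃ x', x = v ++ x' ∧ star (wordProd t v) * wordProd t x = wordProd t x') ∨
    (∃ v', v = x ++ v' ∧ star (wordProd t v) * wordProd t x = star (wordProd t v')) ∨
    star (wordProd t v) * wordProd t x = 0 := by
  induction v generalizing x with
  | nil => exact Or.inl ⟨x, rfl, by simp⟩
  | cons i v ih =>
    cases x with
    | nil => exact Or.inr (Or.inl ⟨i :: v, rfl, by simp⟩)
    | cons k x =>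
      have e : star (wordProd t (i :: v)) * wordProd t (k :: x) =
          if i = k then star (wordProd t v) * wordProd t x else 0 := by
        rw [wordProd_cons, wordProd_cons, star_mul, mul_assoc, ← mul_assoc (star (t i)), h.orth]
        split_ifs <;> simp
      rw [e]
      by_cases hik : i = k
      · subst hik
        rw [if_pos rfl]
        rcases ih x with ⟨x', rfl, hx⟩ | ⟨v', rfl, hv⟩ | h0
        · exact Or.inl ⟨x', rfl, hx⟩
        · exact Or.inr (Or.inl ⟨v', rfl, hv⟩)
        · exact Or.inr (Or.inr h0)
      · exact Or.inr (Or.inr (if_neg hik))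

theorem sum_word_mul_star (k : ℕ) :
    ∑ w ∈ words n k, wordProd t w * star (wordProd t w) = 1 := by
  have h1 : ∀ k, (rowConj t)^[k] 1 = 1 := by
    intro k
    induction k with
    | zero => rfl
    | succ k ih => rw [Function.iterate_succ_apply', ih]; simp [rowConj, h.sum]
  rw [← h1 k, rowConj_iterate]
  simp

/-- Block diagonal sums along a Cuntz family are contractive. -/
theorem norm_sum_conj_le (a : Fin n → E) {C : ℝ} (hC : 0 ≤ C) (ha : ∀ i, ‖a i‖ ≤ C) :
    ‖∑ i, t i * a i * star (t i)‖ ≤ C := by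
  -- Orthogonality of the ranges makes the block diagonal sum a `*`-homomorphism, and these are
  -- contractive.
  let ψ : (Fin n → E) →⋆ₙₐ[ℂ] E :=
    { toFun := fun a => ∑ i, t i * a i * star (t i)
      map_smul' := fun c a => by simp [Finset.smul_sum]
      map_zero' := by simp
      map_add' := fun a b => by simp [mul_add, add_mul, Finset.sum_add_distrib]
      map_mul' := fun a b => by
        rw [Finset.sum_mul]
        refine Finset.sum_congr rfl fun i _ => ?_
        rw [Finset.mul_sum, Finset.sum_eq_single i]
        · have := h.orth i i
          rw [if_pos rfl] at this
          calc t i * (a * b) i * star (t i) = t i * a i * 1 * b i * star (t i) := by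
                rw [Pi.mul_apply, mul_one]; simp only [mul_assoc]
            _ = _ := by rw [← this]; simp only [mul_assoc]
        · intro k _ hk
          have := h.orth i k
          rw [if_neg hk.symm] at this
          calc _ = t i * a i * (star (t i) * t k) * b k * star (t k) := by simp only [mul_assoc]
            _ = 0 := by rw [this]; simp
        · simp
      map_star' := fun a => by simp [mul_assoc] }
  refine (NonUnitalStarAlgHom.norm_apply_le ψ a).trans ?_
  exact (pi_norm_le_iff_of_nonneg hC).mpr ha

theorem norm_gen_le (i : Fin n) : ‖t i‖ ≤ 1 := by
  have h1 := CStarRing.norm_star_mul_self (x := t i)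
  rw [h.orth, if_pos rfl] at h1
  nlinarith [norm_one_le (E := E), norm_nonneg (t i)]

theorem norm_rowConj_iterate_le (k : ℕ) (b : E) : ‖(rowConj t)^[k] b‖ ≤ ‖b‖ := by
  induction k with
  | zero => rfl
  | succ k ih =>
    rw [Function.iterate_succ_apply']
    exact h.norm_sum_conj_le _ (norm_nonneg _) fun _ => ih

/-- If the representation of `C(X̃)` is faithful on `C(X)`, it is faithful. -/
theorem injective (hX : ∀ f : C(X, ℂ), π (f.comp (coverProj σ)) = 0 → f = 0) :
    Function.Injective π := by
  rw [injective_iff_map_eq_zero]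
  intro g hg
  by_contra hne
  obtain ⟨w, f, k, -, ⟨x, hx⟩, e⟩ := exists_mul_comp_coverWord hne
  -- Since `t_w^* π(g) t_w = π(g ∘ σ̃_w)`, the kernel is stable under composition with `σ̃_w`.
  have h1 : π (g.comp (coverWord σ w)) = 0 := by
    have := h.map_mul_word g w
    rw [hg, zero_mul] at this
    rw [← one_mul (π _), ← h.star_word_mul_self w, mul_assoc, ← this, mul_zero]
  have h2 := hX _ (by rw [← e, map_mul, h1, mul_zero])
  have h3 := congrArg (fun F : C(X, ℂ) => F x) h2
  simp [hx] at h3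

end IsCuntzPair

end CuntzRelations

/-! ### The core and its diagonal. -/

section CoreAlgebra

open Filter Topology

variable {X : Type u} [TopologicalSpace X] {n : ℕ} {σ : Fin n → C(X, X)}
  {E : Type u} [CStarAlgebra E]

/-- The elements `t_u g t_v^*` with `|u| = |v|` and `g ∈ 𝓘`. -/
def coreGen (t : Fin n → E) (π : C(Cover σ, ℂ) →⋆ₐ[ℂ] E) (𝓘 : Set C(Cover σ, ℂ)) : Set E :=
  {b | ∃ u v : List (Fin n), ∃ g ∈ 𝓘, u.length = v.length ∧
    b = wordProd t u * π g * star (wordProd t v)}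

/-- The closed linear span of the elements `t_u g t_v^*` with `|u| = |v|` and `g ∈ 𝓘`. -/
def coreOf (t : Fin n → E) (π : C(Cover σ, ℂ) →⋆ₐ[ℂ] E) (𝓘 : Set C(Cover σ, ℂ)) :
    Submodule ℂ E :=
  (Submodule.span ℂ (coreGen t π 𝓘)).topologicalClosure

theorem core_eq_coreOf (j : CovAlg σ →ₐ[ℂ] E) (π : C(Cover σ, ℂ) →⋆ₐ[ℂ] E) :
    core σ j π = coreOf (fun i => j (gen σ i)) π Set.univ := by
  rw [core, coreOf]
  congr 2
  ext b
  constructor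
  · rintro ⟨u, v, g, hl, rfl⟩
    exact ⟨u, v, g, trivial, hl, rfl⟩
  · rintro ⟨u, v, g, -, hl, rfl⟩
    exact ⟨u, v, g, hl, rfl⟩

variable {t : Fin n → E} {π : C(Cover σ, ℂ) →⋆ₐ[ℂ] E}

theorem mem_coreOf {𝓘 : Set C(Cover σ, ℂ)} {u v : List (Fin n)} (hl : u.length = v.length)
    {g : C(Cover σ, ℂ)} (hg : g ∈ 𝓘) : wordProd t u * π g * star (wordProd t v) ∈ coreOf t π 𝓘 :=
  Submodule.le_topologicalClosure _ (Submodule.subset_span ⟨u, v, g, hg, hl, rfl⟩)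

theorem map_mem_coreOf {𝓘 : Set C(Cover σ, ℂ)} {g : C(Cover σ, ℂ)} (hg : g ∈ 𝓘) :
    π g ∈ coreOf t π 𝓘 := by
  have := mem_coreOf (t := t) (π := π) (u := []) (v := []) rfl hg
  simpa using this

theorem word_mul_star_mem_coreOf {u v : List (Fin n)} (hl : u.length = v.length) :
    wordProd t u * star (wordProd t v) ∈ coreOf t π Set.univ := by
  have := mem_coreOf (t := t) (π := π) hl (Set.mem_univ (1 : C(Cover σ, ℂ)))
  simpa using this

theorem isClosed_coreOf (𝓘 : Set C(Cover σ, ℂ)) : IsClosed (coreOf t π 𝓘 : Set E) :=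
  Submodule.isClosed_topologicalClosure _

/-- Elements of closed spans multiply into a closed subspace if the generators do. -/
theorem mul_mem_of_generators {G₁ G₂ : Set E} {J : Submodule ℂ E} (hJ : IsClosed (J : Set E))
    (hG : ∀ a ∈ G₁, ∀ b ∈ G₂, a * b ∈ J) :
    ∀ a ∈ (Submodule.span ℂ G₁).topologicalClosure,
      ∀ b ∈ (Submodule.span ℂ G₂).topologicalClosure, a * b ∈ J := by
  have h1 : ∀ a ∈ G₁, ∀ b ∈ (Submodule.span ℂ G₂).topologicalClosure, a * b ∈ J := by
    intro a ha
    have : (Submodule.span ℂ G₂).topologicalClosure ≤ J.comap (LinearMap.mulLeft ℂ a) :=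
      Submodule.topologicalClosure_minimal _ (Submodule.span_le.mpr fun b hb => hG a ha b hb)
        (hJ.preimage (continuous_const_mul a))
    exact this
  intro a ha b hb
  have : (Submodule.span ℂ G₁).topologicalClosure ≤ J.comap (LinearMap.mulRight ℂ b) :=
    Submodule.topologicalClosure_minimal _ (Submodule.span_le.mpr fun a ha => h1 a ha b hb)
      (hJ.preimage (continuous_mul_const b))
  exact this ha

/-- The diagonal part of level `l`. -/
def diagPart (t : Fin n → E) : ℕ → E →ₗ[ℂ] E
  | 0 => LinearMap.id
  | l + 1 => ∑ i, (LinearMap.mulRight ℂ (star (t i))) ∘ₗ (LinearMap.mulLeft ℂ (t i)) ∘ₗ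
      diagPart t l ∘ₗ (LinearMap.mulRight ℂ (t i)) ∘ₗ (LinearMap.mulLeft ℂ (star (t i)))

theorem diagPart_zero (b : E) : diagPart t 0 b = b := rfl

theorem diagPart_succ (l : ℕ) (b : E) :
    diagPart t (l + 1) b = ∑ i, t i * diagPart t l (star (t i) * b * t i) * star (t i) := by
  simp [diagPart]

/-- The recursive form suits induction on words. This form shows that diagonal parts stay inside
every ideal of the core, since the projections `t_w t_w^*` belong to the core. -/
theorem diagPart_eq_sum (l : ℕ) (b : E) :
    diagPart t l b = ∑ w ∈ words n l, wordProd t w * star (wordProd t w) * b *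
      (wordProd t w * star (wordProd t w)) := by
  induction l generalizing b with
  | zero => simp [diagPart_zero]
  | succ l ih =>
    rw [diagPart_succ, sum_words_succ]
    refine Finset.sum_congr rfl fun i _ => ?_
    rw [ih, Finset.mul_sum, Finset.sum_mul]
    refine Finset.sum_congr rfl fun w _ => ?_
    simp only [wordProd_cons, star_mul, mul_assoc]

/-- The function `Φ(t_u g t_v^*)`. -/
def diagFun : List (Fin n) → List (Fin n) → C(Cover σ, ℂ) → C(Cover σ, ℂ)
  | [], [], g => g
  | i :: u, k :: v, g =>
    if i = k then (diagFun u v g).comp (shift σ) * indexIndicator σ i else 0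
  | _, _, _ => 0

theorem diagFun_eq_zero {Z : Set (Cover σ)} (hZ : ∀ z ∈ Z, shift σ z ∈ Z) {g : C(Cover σ, ℂ)}
    (hg : ∀ z ∈ Z, g z = 0) (u v : List (Fin n)) : ∀ z ∈ Z, diagFun u v g z = 0 := by
  induction u generalizing v with
  | nil =>
    cases v with
    | nil => exact hg
    | cons => exact fun z _ => rfl
  | cons i u ih =>
    cases v with
    | nil => exact fun z _ => rfl
    | cons k v =>
      intro z hz
      rw [diagFun]
      split_ifs
      · rw [ContinuousMap.mul_apply, ContinuousMap.comp_apply, ih v _ (hZ z hz), zero_mul]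
      · rfl

namespace IsCuntzPair

variable [CompactSpace X] [T2Space X] (h : IsCuntzPair t π)

include h

theorem norm_diagPart_le (l : ℕ) (b : E) : ‖diagPart t l b‖ ≤ ‖b‖ := by
  induction l generalizing b with
  | zero => rfl
  | succ l ih =>
    rw [diagPart_succ]
    refine h.norm_sum_conj_le _ (norm_nonneg _) fun i => (ih _).trans ?_
    calc ‖star (t i) * b * t i‖ ≤ ‖star (t i)‖ * ‖b‖ * ‖t i‖ := norm_mul₃_le ..
      _ ≤ 1 * ‖b‖ * 1 := by
        have := h.norm_gen_le i
        gcongr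
        rwa [norm_star]
      _ = ‖b‖ := by ring

theorem diagPart_map (l : ℕ) (g : C(Cover σ, ℂ)) : diagPart t l (π g) = π g := by
  induction l generalizing g with
  | zero => rfl
  | succ l ih =>
    rw [diagPart_succ, h.eq_sum g]
    refine Finset.sum_congr rfl fun i _ => ?_
    rw [← h.eq_sum, h.star_mul_map_mul, if_pos rfl, ih]

/-- Each step of the recursion strips one letter from both words, and distinct letters give zero.
Once the words are used up a function remains, and `diagPart_map` says that further levels leave it
fixed. -/
theorem diagPart_word (u v : List (Fin n)) (hl : u.length = v.length) (g : C(Cover σ, ℂ))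
    (l : ℕ) (hul : u.length ≤ l) :
    diagPart t l (wordProd t u * π g * star (wordProd t v)) = π (diagFun u v g) := by
  induction u generalizing v l with
  | nil =>
    cases v with
    | nil => simp [diagFun, h.diagPart_map]
    | cons => simp at hl
  | cons i u ih =>
    cases v with
    | nil => simp at hl
    | cons k v =>
      cases l with
      | zero => simp at hul
      | succ l =>
        have e : ∀ m, star (t m) * (wordProd t (i :: u) * π g * star (wordProd t (k :: v))) * t m =
            if m = i ∧ k = m then wordProd t u * π g * star (wordProd t v) else 0 := by
          intro m
          rw [wordProd_cons, wordProd_cons, star_mul]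
          calc _ = star (t m) * t i * (wordProd t u * π g * star (wordProd t v)) *
                (star (t k) * t m) := by simp only [mul_assoc]
            _ = _ := by
              rw [h.orth, h.orth]
              by_cases h1 : m = i <;> by_cases h2 : k = m <;> simp [h1, h2]
        rw [diagPart_succ]
        simp only [e]
        by_cases hik : i = k
        · subst hik
          rw [Finset.sum_eq_single i]
          · rw [if_pos ⟨rfl, rfl⟩, ih v (by simpa using hl) l (by simpa using hul), diagFun,
              if_pos rfl, map_mul, h.map_comp_shift, h.map_indexIndicator, rowConj,
              Finset.sum_mul, Finset.sum_eq_single i]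
            · have := h.orth i i
              rw [if_pos rfl] at this
              calc _ = t i * π (diagFun u v g) * 1 * star (t i) := by rw [mul_one]
                _ = _ := by rw [← this]; simp only [mul_assoc]
            · intro m _ hm
              have := h.orth m i
              rw [if_neg hm] at this
              calc _ = t m * π (diagFun u v g) * (star (t m) * t i) * star (t i) := by
                    simp only [mul_assoc]
                _ = 0 := by rw [this]; simp
            · simp
          · intro m _ hm
            rw [if_neg fun hc => hm hc.1]
            simp
          · simp
        · rw [diagFun, if_neg hik, map_zero]
          refine Finset.sum_eq_zero fun m _ => ?_
          rw [if_neg fun hc => hik (hc.1.symm.trans hc.2.symm)]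
          simp

/-- The diagonal parts of an element of the algebraic span are eventually functions. -/
theorem exists_diagPart_eq {𝓘 : Set C(Cover σ, ℂ)} {K : Submodule ℂ C(Cover σ, ℂ)}
    (hK : ∀ u v, ∀ g ∈ 𝓘, diagFun u v g ∈ K) {b : E}
    (hb : b ∈ Submodule.span ℂ (coreGen t π 𝓘)) :
    ∃ g ∈ K, ∃ L, ∀ l ≥ L, diagPart t l b = π g := by
  induction hb using Submodule.span_induction with
  | mem b hb =>
    obtain ⟨u, v, g, hg, hl, rfl⟩ := hb
    exact ⟨diagFun u v g, hK u v g hg, u.length, fun l hul => h.diagPart_word u v hl g l hul⟩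
  | zero => exact ⟨0, K.zero_mem, 0, fun l _ => by simp⟩
  | add a b _ _ ha hb =>
    obtain ⟨g, hg, L, hL⟩ := ha
    obtain ⟨g', hg', L', hL'⟩ := hb
    exact ⟨g + g', K.add_mem hg hg', max L L', fun l hl => by
      rw [map_add, map_add, hL l (le_of_max_le_left hl), hL' l (le_of_max_le_right hl)]⟩
  | smul c a _ ha =>
    obtain ⟨g, hg, L, hL⟩ := ha
    exact ⟨c • g, K.smul_mem c hg, L, fun l hl => by rw [map_smul, map_smul, hL l hl]⟩

/-- The diagonal parts of an element of the core converge to a function. -/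
theorem exists_tendsto_diagPart (hπ : Function.Injective π) {b : E}
    (hb : b ∈ coreOf t π Set.univ) :
    ∃ g, Tendsto (fun l => diagPart t l b) atTop (𝓝 (π g)) := by
  -- Diagonal parts are contractive and eventually constant on the algebraic span, so approximation
  -- makes them Cauchy on the closure.
  have happrox : ∀ ε > 0, ∃ g L, ∀ l ≥ L, ‖diagPart t l b - π g‖ < ε := by
    intro ε hε
    obtain ⟨y, hy, hby⟩ := Metric.mem_closure_iff.mp hb ε hε
    obtain ⟨g, -, L, hL⟩ := h.exists_diagPart_eq (K := ⊤) (fun _ _ _ _ => trivial) hy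
    refine ⟨g, L, fun l hl => ?_⟩
    rw [← hL l hl, ← map_sub]
    exact (h.norm_diagPart_le l _).trans_lt (by rwa [← dist_eq_norm])
  have hcauchy : CauchySeq fun l => diagPart t l b := by
    refine Metric.cauchySeq_iff.mpr fun ε hε => ?_
    obtain ⟨g, L, hL⟩ := happrox (ε / 2) (half_pos hε)
    refine ⟨L, fun l hl l' hl' => ?_⟩
    calc dist (diagPart t l b) (diagPart t l' b)
        ≤ dist (diagPart t l b) (π g) + dist (diagPart t l' b) (π g) := dist_triangle_right _ _ _
      _ < ε / 2 + ε / 2 := by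
        rw [dist_eq_norm, dist_eq_norm]
        exact add_lt_add (hL l hl) (hL l' hl')
      _ = ε := add_halves ε
  obtain ⟨e, he⟩ := cauchySeq_tendsto_of_complete hcauchy
  -- An injective `π` is isometric, so its range is complete and contains the limit.
  have hclosed : IsClosed (Set.range π) :=
    (NonUnitalStarAlgHom.isometry π hπ).isClosedEmbedding.isClosed_range
  have hmem : e ∈ Set.range π := by
    rw [← hclosed.closure_eq, Metric.mem_closure_iff]
    intro ε hε
    obtain ⟨g, L, hL⟩ := happrox (ε / 2) (half_pos hε)
    refine ⟨π g, ⟨g, rfl⟩, ?_⟩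
    rw [dist_eq_norm]
    have h1 : Tendsto (fun l => ‖diagPart t l b - π g‖) atTop (𝓝 ‖e - π g‖) :=
      (he.sub_const _).norm
    have h2 := le_of_tendsto h1 (eventually_atTop.mpr ⟨L, fun l hl => (hL l hl).le⟩)
    linarith
  obtain ⟨g, rfl⟩ := hmem
  exact ⟨g, he⟩

end IsCuntzPair

end CoreAlgebra

/-! ### Ideals of the core that meet the diagonal trivially. -/

section CoreIdeals

open Filter Topology

variable {X : Type u} [TopologicalSpace X] [CompactSpace X] [T2Space X] {n : ℕ}
  {σ : Fin n → C(X, X)} {E : Type u} [CStarAlgebra E]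
  {t : Fin n → E} {π : C(Cover σ, ℂ) →⋆ₐ[ℂ] E}

/-- The iterates of the shift. -/
def shiftPow (σ : Fin n → C(X, X)) : ℕ → C(Cover σ, Cover σ)
  | 0 => ContinuousMap.id _
  | m + 1 => (shiftPow σ m).comp (shift σ)

namespace IsCuntzPair

variable (h : IsCuntzPair t π)

/-- The matrices over `C(X̃)` indexed by the words of length `k` inside the core. -/
def levelHom (k : ℕ) : CStarMatrix (words n k) (words n k) C(Cover σ, ℂ) →⋆ₙₐ[ℂ] E where
  toFun A := ∑ u : words n k, ∑ v : words n k, wordProd t u * π (A u v) * star (wordProd t v)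
  map_smul' c A := by simp [Finset.smul_sum]
  map_zero' := by simp
  map_add' A B := by simp [mul_add, add_mul, Finset.sum_add_distrib]
  map_mul' A B := by
    have key : ∀ u v : words n k, (∑ y : words n k, wordProd t u * π (A u y) * star (wordProd t y)) *
        (∑ x : words n k, wordProd t x * π (B x v) * star (wordProd t v)) =
        wordProd t u * π ((A * B) u v) * star (wordProd t v) := by
      intro u v
      rw [Finset.sum_mul, CStarMatrix.mul_apply, map_sum, Finset.mul_sum, Finset.sum_mul]
      refine Finset.sum_congr rfl fun y _ => ?_
      rw [Finset.mul_sum, Finset.sum_eq_single y]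
      · rw [map_mul]
        calc _ = wordProd t u * π (A u y) * (star (wordProd t y) * wordProd t y) * π (B y v) *
              star (wordProd t v) := by simp only [mul_assoc]
          _ = _ := by rw [h.star_word_mul_self]; simp only [mul_assoc, one_mul]
      · intro x _ hx
        calc _ = wordProd t u * π (A u y) * (star (wordProd t y) * wordProd t x) * π (B x v) *
              star (wordProd t v) := by simp only [mul_assoc]
          _ = 0 := by
            rw [h.star_word_mul_word_of_length
              ((mem_words.mp y.2).trans (mem_words.mp x.2).symm), if_neg]
            · simp
            · exact fun e => hx (Subtype.ext e.symm)
      · simp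
    simp only [← key]
    rw [Finset.sum_comm (f := fun x v : words n k => wordProd t x * π (B x v) * star (wordProd t v)),
      Finset.sum_mul_sum]
  map_star' A := by
    rw [star_sum, Finset.sum_comm]
    refine Finset.sum_congr rfl fun u _ => ?_
    rw [star_sum]
    refine Finset.sum_congr rfl fun v _ => ?_
    rw [CStarMatrix.star_apply, map_star]
    simp [mul_assoc]

theorem levelHom_apply (k : ℕ) (A : CStarMatrix (words n k) (words n k) C(Cover σ, ℂ)) :
    h.levelHom k A = ∑ u : words n k, ∑ v : words n k, wordProd t u * π (A u v) * star (wordProd t v) := rfl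

-- Inserting `g = ∑ tᵢ (g ∘ σ̃ᵢ) tᵢ^*` lengthens both words by one letter. The algebraic span is
-- therefore an increasing union of matrix levels.
include h in
theorem span_word_le_succ (k : ℕ) :
    Submodule.span ℂ {b : E | ∃ u v : List (Fin n), ∃ g, u.length = k ∧ v.length = k ∧
      b = wordProd t u * π g * star (wordProd t v)} ≤
    Submodule.span ℂ {b : E | ∃ u v : List (Fin n), ∃ g, u.length = k + 1 ∧ v.length = k + 1 ∧
      b = wordProd t u * π g * star (wordProd t v)} := by
  rw [Submodule.span_le]
  rintro _ ⟨u, v, g, hu, hv, rfl⟩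
  rw [h.eq_sum g, Finset.mul_sum, Finset.sum_mul]
  refine Submodule.sum_mem _ fun i _ => Submodule.subset_span
    ⟨u ++ [i], v ++ [i], g.comp (coverMap σ i), by simp [hu], by simp [hv], ?_⟩
  rw [wordProd_append, wordProd_append]
  simp [mul_assoc]

theorem exists_levelHom_eq {b : E} (hb : b ∈ Submodule.span ℂ (coreGen t π Set.univ)) :
    ∃ k A, b = h.levelHom k A := by
  let L : ℕ → Submodule ℂ E := fun k =>
    Submodule.span ℂ {b : E | ∃ u v : List (Fin n), ∃ g, u.length = k ∧ v.length = k ∧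
      b = wordProd t u * π g * star (wordProd t v)}
  have hmono : Monotone L := monotone_nat_of_le_succ h.span_word_le_succ
  have h1 : ∃ k, b ∈ L k := by
    induction hb using Submodule.span_induction with
    | mem b hb =>
      obtain ⟨u, v, g, -, hl, rfl⟩ := hb
      exact ⟨u.length, Submodule.subset_span ⟨u, v, g, rfl, hl.symm, rfl⟩⟩
    | zero => exact ⟨0, Submodule.zero_mem _⟩
    | add a b _ _ ha hb =>
      obtain ⟨k, hk⟩ := ha
      obtain ⟨l, hl⟩ := hb
      exact ⟨max k l, Submodule.add_mem _ (hmono (le_max_left k l) hk)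
        (hmono (le_max_right k l) hl)⟩
    | smul c a _ ha =>
      obtain ⟨k, hk⟩ := ha
      exact ⟨k, Submodule.smul_mem _ c hk⟩
  obtain ⟨k, hk⟩ := h1
  have h2 : L k ≤ LinearMap.range (h.levelHom k :
      CStarMatrix (words n k) (words n k) C(Cover σ, ℂ) →ₗ[ℂ] E) := by
    refine Submodule.span_le.mpr ?_
    rintro _ ⟨u, v, g, hu, hv, rfl⟩
    refine ⟨CStarMatrix.ofMatrix (Matrix.single ⟨u, mem_words.mpr hu⟩ ⟨v, mem_words.mpr hv⟩ g), ?_⟩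
    change h.levelHom k _ = _
    rw [levelHom_apply, Finset.sum_eq_single ⟨u, mem_words.mpr hu⟩,
      Finset.sum_eq_single ⟨v, mem_words.mpr hv⟩]
    · simp
    · intro y _ hy
      simp [Matrix.single_apply_of_col_ne _ _ hy.symm]
    · simp
    · intro y _ hy
      refine Finset.sum_eq_zero fun x _ => ?_
      simp [Matrix.single_apply_of_row_ne hy.symm]
    · simp
  obtain ⟨A, hA⟩ := h2 hk
  exact ⟨k, A, hA.symm⟩

/-- The operator `∑ ξ_u t_u` over the words of length `k`. -/
def vecOp (t : Fin n → E) {k : ℕ} (ξ : EuclideanSpace ℂ (words n k)) : E :=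
  ∑ u : words n k, ξ u • wordProd t u

-- For words of one length the `t_u` behave like orthonormal vectors: `(∑ ξ_u t_u)^* (∑ ξ_u t_u) =
-- ‖ξ‖²`.
include h in
theorem norm_vecOp_le {k : ℕ} (ξ : EuclideanSpace ℂ (words n k)) : ‖vecOp t ξ‖ ≤ ‖ξ‖ := by
  have h1 : star (vecOp t ξ) * vecOp t ξ = ((‖ξ‖ ^ 2 : ℝ) : ℂ) • 1 := by
    rw [vecOp, star_sum, Finset.sum_mul, EuclideanSpace.norm_sq_eq]
    push_cast
    rw [Finset.sum_smul]
    refine Finset.sum_congr rfl fun u _ => ?_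
    rw [Finset.mul_sum, Finset.sum_eq_single u]
    · rw [star_smul, smul_mul_smul_comm, h.star_word_mul_self, ← Complex.conj_mul']
      rfl
    · intro v _ hv
      rw [star_smul, smul_mul_smul_comm, h.star_word_mul_word_of_length
        ((mem_words.mp u.2).trans (mem_words.mp v.2).symm), if_neg, smul_zero]
      exact fun e => hv (Subtype.ext e.symm)
    · simp
  have h2 := CStarRing.norm_star_mul_self (x := vecOp t ξ)
  rw [h1, norm_smul, Complex.norm_real, Real.norm_of_nonneg (by positivity)] at h2
  have h3 : ‖vecOp t ξ‖ * ‖vecOp t ξ‖ ≤ ‖ξ‖ * ‖ξ‖ := by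
    rw [← h2]
    nlinarith [norm_one_le (E := E), sq_nonneg ‖ξ‖]
  exact le_of_sq_le_sq (by rw [sq, sq]; exact h3) (norm_nonneg _)

theorem star_vecOp_mul_levelHom_mul {k : ℕ} (ξ η : EuclideanSpace ℂ (words n k))
    (A : CStarMatrix (words n k) (words n k) C(Cover σ, ℂ)) :
    star (vecOp t ξ) * h.levelHom k A * vecOp t η =
      π (∑ u : words n k, ∑ v : words n k, (star (ξ u) * η v) • A u v) := by
  have hstar : ∀ u : words n k, star (vecOp t ξ) * wordProd t u = star (ξ u) • 1 := fun u => by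
    rw [vecOp, star_sum, Finset.sum_mul, Finset.sum_eq_single u]
    · rw [star_smul, smul_mul_assoc, h.star_word_mul_self]
    · intro v _ hv
      rw [star_smul, smul_mul_assoc, h.star_word_mul_word_of_length
        ((mem_words.mp v.2).trans (mem_words.mp u.2).symm), if_neg, smul_zero]
      exact fun e => hv (Subtype.ext e)
    · simp
  have hmul : ∀ v : words n k, star (wordProd t v) * vecOp t η = η v • 1 := fun v => by
    rw [vecOp, Finset.mul_sum, Finset.sum_eq_single v]
    · rw [mul_smul_comm, h.star_word_mul_self]
    · intro u _ hu
      rw [mul_smul_comm, h.star_word_mul_word_of_length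
        ((mem_words.mp v.2).trans (mem_words.mp u.2).symm), if_neg, smul_zero]
      exact fun e => hu (Subtype.ext e.symm)
    · simp
  rw [levelHom_apply, Finset.mul_sum, Finset.sum_mul, map_sum]
  refine Finset.sum_congr rfl fun u _ => ?_
  rw [Finset.mul_sum, Finset.sum_mul, map_sum]
  refine Finset.sum_congr rfl fun v _ => ?_
  calc _ = star (vecOp t ξ) * wordProd t u * π (A u v) * (star (wordProd t v) * vecOp t η) := by
        simp only [mul_assoc]
    _ = _ := by
      rw [hstar, hmul, map_smul, smul_mul_assoc, one_mul, mul_smul_comm, mul_one, smul_smul,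
        mul_comm]

include h in
/-- A closed ideal of the core that meets `C(X̃)` trivially vanishes. -/
theorem ideal_eq_bot (hπ : Function.Injective π) {J : Submodule ℂ E}
    (hJ : IsIdealOf (coreOf t π Set.univ) J) (hJπ : ∀ g, π g ∈ J → g = 0) : J = ⊥ := by
  rw [Submodule.eq_bot_iff]
  intro b hb
  have hbound : ∀ ε > 0, ‖b‖ ≤ ε + ε := by
    intro ε hε
    obtain ⟨y, hy, hby⟩ := Metric.mem_closure_iff.mp (hJ.le hb) ε hε
    rw [dist_eq_norm] at hby
    obtain ⟨k, A, rfl⟩ := h.exists_levelHom_eq hy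
    -- It suffices to bound the numbers `⟨ξ, A(z) η⟩`, that is, the function `g` with `π(g) = ξ^* A
    -- η`. This is done by comparing with the compression of `b` and using that the diagonal limit
    -- kills elements of `J`.
    have hA : ‖h.levelHom k A‖ ≤ ε := by
      refine norm_map_le_of_eval_le _ A hε.le fun z ξ η => ?_
      set g := ∑ u : words n k, ∑ v : words n k, (star (ξ u) * η v) • A u v with hg
      have e1 : (∑ u : words n k, ∑ v : words n k, star (ξ u) * (A u v z * η v)) = g z := by
        rw [hg]
        simp only [ContinuousMap.coe_sum, Finset.sum_apply, ContinuousMap.coe_smul,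
          Pi.smul_apply, smul_eq_mul]
        refine Finset.sum_congr rfl fun u _ => Finset.sum_congr rfl fun v _ => ?_
        ring
      rw [e1]
      have hshift : ∀ m, (rowConj t)^[m] (π g) = π (g.comp (shiftPow σ m)) := by
        intro m
        induction m with
        | zero => rfl
        | succ m ih =>
          rw [Function.iterate_succ_apply', ih, ← h.map_comp_shift]
          rfl
      -- The outer factors of `ξ^* b η` are not in the core. Conjugating by `t_w` with `|w| = k`
      -- turns them into combinations of `t_w t_u^*` and `t_v t_w^*`, which are. On functions this
      -- conjugation is composition with the `k`-th shift.
      set b' := (rowConj t)^[k] (star (vecOp t ξ) * b * vecOp t η) with hb'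
      have hb'J : b' ∈ J := by
        rw [hb', rowConj_iterate]
        refine Submodule.sum_mem _ fun w hw => ?_
        have h1 : wordProd t w * star (vecOp t ξ) ∈ coreOf t π Set.univ := by
          rw [vecOp, star_sum, Finset.mul_sum]
          refine Submodule.sum_mem _ fun u _ => ?_
          rw [star_smul, mul_smul_comm]
          exact Submodule.smul_mem _ _ (word_mul_star_mem_coreOf
            ((mem_words.mp hw).trans (mem_words.mp u.2).symm))
        have h2 : vecOp t η * star (wordProd t w) ∈ coreOf t π Set.univ := by
          rw [vecOp, Finset.sum_mul]
          refine Submodule.sum_mem _ fun u _ => ?_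
          rw [smul_mul_assoc]
          exact Submodule.smul_mem _ _ (word_mul_star_mem_coreOf
            ((mem_words.mp u.2).trans (mem_words.mp hw).symm))
        have := hJ.mul_right _ h2 _ (hJ.mul_left _ h1 _ hb)
        simpa only [mul_assoc] using this
      obtain ⟨f, hf⟩ := h.exists_tendsto_diagPart hπ (hJ.le hb'J)
      have hfJ : π f ∈ J := by
        refine hJ.closed.mem_of_tendsto hf (Eventually.of_forall fun l => ?_)
        change diagPart t l b' ∈ J
        rw [diagPart_eq_sum]
        exact Submodule.sum_mem _ fun w _ => hJ.mul_right _ (word_mul_star_mem_coreOf rfl) _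
          (hJ.mul_left _ (word_mul_star_mem_coreOf rfl) _ hb'J)
      rw [hJπ f hfJ, map_zero] at hf
      have h3 : ∀ l, ‖π (g.comp (shiftPow σ k)) - diagPart t l b'‖ ≤ ε * (‖ξ‖ * ‖η‖) := by
        intro l
        rw [← h.diagPart_map l (g.comp (shiftPow σ k)), ← map_sub, ← hshift k, hg,
          ← h.star_vecOp_mul_levelHom_mul, hb', ← rowConj_iterate_sub]
        refine (h.norm_diagPart_le l _).trans ((h.norm_rowConj_iterate_le k _).trans ?_)
        have : star (vecOp t ξ) * h.levelHom k A * vecOp t η -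
            star (vecOp t ξ) * b * vecOp t η =
            star (vecOp t ξ) * (h.levelHom k A - b) * vecOp t η := by
          rw [mul_sub, sub_mul]
        rw [this]
        calc _ ≤ ‖star (vecOp t ξ)‖ * ‖h.levelHom k A - b‖ * ‖vecOp t η‖ := norm_mul₃_le ..
          _ ≤ ‖ξ‖ * ε * ‖η‖ := by
            gcongr
            · rw [norm_star]; exact h.norm_vecOp_le ξ
            · rw [norm_sub_rev]; exact hby.le
            · exact h.norm_vecOp_le η
          _ = ε * (‖ξ‖ * ‖η‖) := by ring
      have h4 : ‖π (g.comp (shiftPow σ k))‖ ≤ ε * (‖ξ‖ * ‖η‖) := by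
        have := le_of_tendsto ((tendsto_const_nhds (x := π (g.comp (shiftPow σ k)))).sub hf).norm
          (Eventually.of_forall h3)
        rwa [sub_zero] at this
      rw [NonUnitalStarAlgHom.norm_map π hπ] at h4
      refine le_trans ?_ h4
      -- The shift is onto, so composing with it does not hide the value `g z`. Any letter could be
      -- prepended here; `firstIndex z` is one that exists.
      have h5 : ∀ m, (shiftPow σ m) (coverWord σ (List.replicate m (firstIndex z)) z) = z := by
        intro m
        induction m with
        | zero => rfl
        | succ m ih =>
          exact ih
      have h6 := (g.comp (shiftPow σ k)).norm_coe_le_norm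
        (coverWord σ (List.replicate k (firstIndex z)) z)
      rwa [ContinuousMap.comp_apply, h5] at h6
    calc ‖b‖ = ‖(b - h.levelHom k A) + h.levelHom k A‖ := by rw [sub_add_cancel]
      _ ≤ ‖b - h.levelHom k A‖ + ‖h.levelHom k A‖ := norm_add_le _ _
      _ ≤ ε + ε := add_le_add hby.le hA
  rw [← norm_eq_zero]
  refine le_antisymm (le_of_forall_pos_le_add fun ε hε => ?_) (norm_nonneg _)
  have := hbound (ε / 2) (half_pos hε)
  linarith

end IsCuntzPair

end CoreIdeals

/-! ### Invariant ideals over a minimal system. -/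

section InvariantIdeals

variable {X : Type u} [TopologicalSpace X] {n : ℕ} {σ : Fin n → C(X, X)}
  {E : Type u} [CStarAlgebra E] {t : Fin n → E} {π : C(Cover σ, ℂ) →⋆ₐ[ℂ] E}

/-- The normalized sum `n^{-1/2} (t₁ + ⋯ + tₙ)`. -/
def avg (t : Fin n → E) : E := (((Real.sqrt n)⁻¹ : ℝ) : ℂ) • ∑ i, t i

theorem star_avg (t : Fin n → E) :
    star (avg t) = (((Real.sqrt n)⁻¹ : ℝ) : ℂ) • ∑ i, star (t i) := by
  rw [avg, star_smul, star_sum, Complex.star_def, Complex.conj_ofReal]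

theorem eq_coreOf_of_one_mem {J : Submodule ℂ E} (hJ : IsIdealOf (coreOf t π Set.univ) J)
    (h1 : (1 : E) ∈ J) : J = coreOf t π Set.univ :=
  le_antisymm hJ.le fun b hb => by simpa using hJ.mul_left b hb 1 h1

namespace IsCuntzPair

variable [CompactSpace X] [T2Space X] (h : IsCuntzPair t π)
include h

theorem star_mul_avg (i : Fin n) : star (t i) * avg t = (((Real.sqrt n)⁻¹ : ℝ) : ℂ) • 1 := by
  rw [avg, mul_smul_comm, Finset.mul_sum, Finset.sum_eq_single i]
  · rw [h.orth, if_pos rfl]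
  · intro k _ hk
    rw [h.orth, if_neg hk.symm]
  · simp

theorem star_avg_mul (i : Fin n) : star (avg t) * t i = (((Real.sqrt n)⁻¹ : ℝ) : ℂ) • 1 := by
  have := congrArg star (h.star_mul_avg i)
  rwa [star_mul, star_star, star_smul, star_one, Complex.star_def, Complex.conj_ofReal] at this

theorem star_avg_mul_avg (hn : n ≠ 0) : star (avg t) * avg t = 1 := by
  have hc : (((Real.sqrt n)⁻¹ : ℝ) : ℂ) * (n * (((Real.sqrt n)⁻¹ : ℝ) : ℂ)) = 1 := by
    have hr : (Real.sqrt n)⁻¹ * (n * (Real.sqrt n)⁻¹) = (1 : ℝ) := by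
      have h1 : Real.sqrt n ≠ 0 := Real.sqrt_ne_zero'.mpr (by positivity)
      have h2 := Real.mul_self_sqrt (Nat.cast_nonneg (α := ℝ) n)
      field_simp
      rw [sq, h2]
    exact_mod_cast hr
  rw [star_avg, smul_mul_assoc, Finset.sum_mul]
  simp only [h.star_mul_avg]
  rw [Finset.sum_const, Finset.card_univ, Fintype.card_fin, ← Nat.cast_smul_eq_nsmul ℂ,
    smul_smul, smul_smul, mul_assoc, hc, one_smul]

/-- Compressing `α(x)` by the projection `tᵢ tᵢ^*` of the core isolates `(1/n) tᵢ x tᵢ^*`. -/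
theorem gen_conj_mem (hn : n ≠ 0) {J : Submodule ℂ E} (hJ : IsIdealOf (coreOf t π Set.univ) J)
    (hα : IsInvariant (fun b => avg t * b * star (avg t)) J) {x : E} (hx : x ∈ J) (i : Fin n) :
    t i * x * star (t i) ∈ J := by
  set c : ℂ := (((Real.sqrt n)⁻¹ : ℝ) : ℂ) with hc
  have hc0 : c ≠ 0 := by
    rw [hc]
    exact_mod_cast inv_ne_zero (Real.sqrt_ne_zero'.mpr (by positivity))
  have hi : t i * star (t i) ∈ coreOf t π Set.univ := by
    simpa using word_mul_star_mem_coreOf (t := t) (π := π) (u := [i]) (v := [i]) rfl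
  have h1 := hJ.mul_right _ hi _ (hJ.mul_left _ hi _ (hα x hx))
  have h2 : t i * star (t i) * (avg t * x * star (avg t)) * (t i * star (t i)) =
      (c * c) • (t i * x * star (t i)) := by
    calc _ = t i * (star (t i) * avg t) * x * (star (avg t) * t i) * star (t i) := by
          simp only [mul_assoc]
      _ = _ := by
        rw [h.star_mul_avg, h.star_avg_mul, ← hc]
        simp only [mul_smul_comm, smul_mul_assoc, mul_one, smul_smul]
  rw [h2] at h1
  exact (J.smul_mem_iff (mul_ne_zero hc0 hc0)).mp h1

end IsCuntzPair

/-- The functions `g` with `t_u g t_u^* ∈ J` for all words `u` of length `m`. -/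
def levelFun (t : Fin n → E) (π : C(Cover σ, ℂ) →⋆ₐ[ℂ] E) (J : Submodule ℂ E) (m : ℕ) :
    Submodule ℂ C(Cover σ, ℂ) where
  carrier := {g | ∀ u : List (Fin n), u.length = m → wordProd t u * π g * star (wordProd t u) ∈ J}
  add_mem' ha hb u hu := by
    rw [map_add, mul_add, add_mul]
    exact J.add_mem (ha u hu) (hb u hu)
  zero_mem' u _ := by simp
  smul_mem' c g hg u hu := by
    rw [map_smul, mul_smul_comm, smul_mul_assoc]
    exact J.smul_mem c (hg u hu)

namespace IsCuntzPair

variable [CompactSpace X] [T2Space X] (h : IsCuntzPair t π) {J : Submodule ℂ E} (hJ : IsIdealOf (coreOf t π Set.univ) J)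
include h hJ

/-- The matrix units `t_u t_w^*` lie in the core, so one word of a given length decides for all of
them. -/
theorem mem_levelFun_of_word {g : C(Cover σ, ℂ)} {w : List (Fin n)}
    (hw : wordProd t w * π g * star (wordProd t w) ∈ J) : g ∈ levelFun t π J w.length := by
  intro u hu
  have h1 := hJ.mul_right _ (word_mul_star_mem_coreOf hu.symm) _
    (hJ.mul_left _ (word_mul_star_mem_coreOf hu) _ hw)
  have h2 : wordProd t u * star (wordProd t w) * (wordProd t w * π g * star (wordProd t w)) *
      (wordProd t w * star (wordProd t u)) = wordProd t u * π g * star (wordProd t u) := by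
    calc _ = wordProd t u * (star (wordProd t w) * wordProd t w) * π g *
          (star (wordProd t w) * wordProd t w) * star (wordProd t u) := by simp only [mul_assoc]
      _ = _ := by rw [h.star_word_mul_self]; simp
  rwa [h2] at h1

theorem mul_mem_levelFun {m : ℕ} {g : C(Cover σ, ℂ)} (hg : g ∈ levelFun t π J m)
    (k : C(Cover σ, ℂ)) : k * g ∈ levelFun t π J m := by
  intro u hu
  have h1 := hJ.mul_left _ (mem_coreOf (t := t) (π := π) (u := u) (v := u) rfl
    (Set.mem_univ k)) _ (hg u hu)
  have h2 : wordProd t u * π k * star (wordProd t u) *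
      (wordProd t u * π g * star (wordProd t u)) =
      wordProd t u * π (k * g) * star (wordProd t u) := by
    calc _ = wordProd t u * π k * (star (wordProd t u) * wordProd t u) * π g *
          star (wordProd t u) := by simp only [mul_assoc]
      _ = _ := by rw [h.star_word_mul_self, map_mul]; simp [mul_assoc]
  rwa [h2] at h1

/-- For a word `a` of length `m`, multiplying `t_a g t_a^*` by the range projection of `t_{av}`
leaves `t_{av} (g ∘ σ̃_v) t_{av}^*`. -/
theorem comp_mem_levelFun [NeZero n] {m : ℕ} {g : C(Cover σ, ℂ)} (hg : g ∈ levelFun t π J m)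
    (v : List (Fin n)) : g.comp (coverWord σ v) ∈ levelFun t π J (m + v.length) := by
  set a : List (Fin n) := List.replicate m 0 with ha
  have hl : a.length = m := by simp [ha]
  have h1 := hJ.mul_right _ (word_mul_star_mem_coreOf (u := a ++ v) (v := a ++ v) rfl) _ (hg a hl)
  have h2 : wordProd t a * π g * star (wordProd t a) *
      (wordProd t (a ++ v) * star (wordProd t (a ++ v))) =
      wordProd t (a ++ v) * π (g.comp (coverWord σ v)) * star (wordProd t (a ++ v)) := by
    rw [wordProd_append]
    calc _ = wordProd t a * π g * (star (wordProd t a) * wordProd t a) * wordProd t v *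
          star (wordProd t a * wordProd t v) := by simp only [mul_assoc]
      _ = wordProd t a * (π g * wordProd t v) * star (wordProd t a * wordProd t v) := by
        rw [h.star_word_mul_self]; simp only [mul_assoc, one_mul]
      _ = _ := by rw [h.map_mul_word]; simp only [mul_assoc]
  rw [h2] at h1
  have h3 := h.mem_levelFun_of_word hJ h1
  rwa [List.length_append, hl] at h3

/-- This is where invariance enters: it allows a letter to be prepended without changing the
function. -/
theorem levelFun_mono (hn : n ≠ 0) (hα : IsInvariant (fun b => avg t * b * star (avg t)) J) :
    Monotone (levelFun t π J) := by
  refine monotone_nat_of_le_succ fun m g hg u hu => ?_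
  cases u with
  | nil => simp at hu
  | cons i u =>
    have := h.gen_conj_mem hn hJ hα (hg u (by simpa using hu)) i
    simpa only [wordProd_cons, star_mul, mul_assoc] using this

omit hJ in
theorem one_mem_of_levelFun {m : ℕ} (hm : 1 ∈ levelFun t π J m) : (1 : E) ∈ J := by
  rw [← h.sum_word_mul_star m]
  refine J.sum_mem fun w hw => ?_
  simpa using hm w (mem_words.mp hw)

/-- For a minimal system, an invariant ideal that contains a nonzero function is everything. -/
theorem one_mem_of_isMinimal (hn : n ≠ 0) (hmin : IsMinimal σ)
    (hα : IsInvariant (fun b => avg t * b * star (avg t)) J) {g : C(Cover σ, ℂ)} (hg : g ≠ 0)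
    (hgJ : π g ∈ J) : (1 : E) ∈ J := by
  have : NeZero n := ⟨hn⟩
  obtain ⟨w, f, k, hf0, ⟨x, hx⟩, e⟩ := exists_mul_comp_coverWord hg
  set F : C(Cover σ, ℂ) :=
    ((⟨Complex.ofReal, Complex.continuous_ofReal⟩ : C(ℝ, ℂ)).comp f).comp (coverProj σ) with hF
  have hFm : F ∈ levelFun t π J w.length := by
    rw [← e]
    refine h.mul_mem_levelFun hJ ?_ k
    have h0 : g ∈ levelFun t π J 0 := by
      refine h.mem_levelFun_of_word hJ (w := []) ?_
      simpa using hgJ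
    simpa using h.comp_mem_levelFun hJ h0 w
  -- Every orbit meets the open set where `f > 0`, and compactness of `X̃` reduces to finitely many
  -- words.
  obtain ⟨s, hs⟩ : ∃ s : Finset (List (Fin n)), ∀ z : Cover σ, ∃ v ∈ s,
      0 < f (coverProj σ (coverWord σ v z)) := by
    obtain ⟨s, hs⟩ := isCompact_univ.elim_finite_subcover
      (fun v : List (Fin n) => {z : Cover σ | 0 < f (coverProj σ (coverWord σ v z))})
      (fun v => isOpen_lt continuous_const (by fun_prop)) (fun z _ => by
        obtain ⟨_, hy, ⟨v, rfl⟩⟩ := (hmin (coverProj σ z)).inter_open_nonempty {y | 0 < f y}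
          (isOpen_lt continuous_const f.continuous) ⟨x, by simp [hx]⟩
        refine Set.mem_iUnion.mpr ⟨v, ?_⟩
        change 0 < f (coverProj σ (coverWord σ v z))
        rw [coverProj_coverWord]
        exact hy)
    refine ⟨s, fun z => ?_⟩
    obtain ⟨v, hv, hz⟩ := Set.mem_iUnion₂.mp (hs (Set.mem_univ z))
    exact ⟨v, hv, hz⟩
  -- The summands lie at levels `|w| + |v|` that vary with `v`; monotonicity moves all of them to
  -- the largest one. Their sum is strictly positive, hence invertible.
  set G : C(Cover σ, ℂ) := ∑ v ∈ s, F.comp (coverWord σ v) with hG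
  have hGm : G ∈ levelFun t π J (w.length + s.sup List.length) := by
    refine Submodule.sum_mem _ fun v hv => ?_
    exact h.levelFun_mono hJ hn hα (Nat.add_le_add_left (Finset.le_sup hv) _)
      (h.comp_mem_levelFun hJ hFm v)
  have hGu : IsUnit G := by
    rw [ContinuousMap.isUnit_iff_forall_ne_zero]
    intro z hz
    have h1 : G z = ((∑ v ∈ s, f (coverProj σ (coverWord σ v z)) : ℝ) : ℂ) := by
      rw [hG, ContinuousMap.sum_apply]
      push_cast
      rfl
    rw [h1, Complex.ofReal_eq_zero] at hz
    obtain ⟨v, hv, hpos⟩ := hs z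
    exact (Finset.sum_pos' (f := fun v => f (coverProj σ (coverWord σ v z)))
      (fun _ _ => hf0 _) ⟨v, hv, hpos⟩).ne' hz
  obtain ⟨G', hG'⟩ := hGu.exists_left_inv
  exact h.one_mem_of_levelFun (hG' ▸ h.mul_mem_levelFun hJ hGm G')

/-- For a minimal system, the core has no proper invariant ideals. -/
theorem eq_bot_or_eq_of_isMinimal (hn : n ≠ 0) (hπ : Function.Injective π) (hmin : IsMinimal σ)
    (hα : IsInvariant (fun b => avg t * b * star (avg t)) J) :
    J = ⊥ ∨ J = coreOf t π Set.univ := by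
  by_cases hJπ : ∀ g, π g ∈ J → g = 0
  · exact Or.inl (h.ideal_eq_bot hπ hJ hJπ)
  · push Not at hJπ
    obtain ⟨g, hgJ, hg⟩ := hJπ
    exact Or.inr (eq_coreOf_of_one_mem hJ (h.one_mem_of_isMinimal hJ hn hmin hα hg hgJ))

end IsCuntzPair

end InvariantIdeals

/-! ### Invariant sets in the cover of a system that is not minimal. -/

section InvariantSets

variable {X : Type u} [TopologicalSpace X] {n : ℕ} {σ : Fin n → C(X, X)}

/-- The functions that vanish on `Z`. -/
def vanishing (Z : Set (Cover σ)) : Submodule ℂ C(Cover σ, ℂ) where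
  carrier := {g | ∀ z ∈ Z, g z = 0}
  add_mem' ha hb z hz := by rw [ContinuousMap.add_apply, ha z hz, hb z hz, add_zero]
  zero_mem' _ _ := rfl
  smul_mem' c g hg z hz := by rw [ContinuousMap.smul_apply, hg z hz, smul_zero]

theorem coverWord_mem {Z : Set (Cover σ)} (hZ : ∀ i, ∀ z ∈ Z, coverMap σ i z ∈ Z)
    (w : List (Fin n)) : ∀ z ∈ Z, coverWord σ w z ∈ Z := by
  induction w with
  | nil => exact fun z hz => hz
  | cons i w ih => exact fun z hz => hZ i _ (ih z hz)

/-- A system that is not minimal has a proper invariant set in its covering space. -/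
theorem exists_invariant_set [CompactSpace X] [T2Space X] (hσ : IsSurjective σ)
    (hmin : ¬ IsMinimal σ) :
    ∃ Z : Set (Cover σ), Z.Nonempty ∧ (∀ i, ∀ z ∈ Z, coverMap σ i z ∈ Z) ∧
      (∀ z ∈ Z, shift σ z ∈ Z) ∧ ∃ g ∈ vanishing Z, g ≠ 0 := by
  obtain ⟨x, hx⟩ : ∃ x, ¬ Dense (orbit σ x) := by
    simpa [IsMinimal] using hmin
  set Y := closure (orbit σ x) with hY
  have hYσ : ∀ i, ∀ y ∈ Y, σ i y ∈ Y := fun i y hy =>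
    map_mem_closure (σ i).continuous hy fun _ ⟨w, hw⟩ => ⟨i :: w, by rw [← hw]; rfl⟩
  have hxY : x ∈ Y := subset_closure ⟨[], rfl⟩
  obtain ⟨x', hx'⟩ : ∃ x', x' ∉ Y := by
    by_contra hcon
    push Not at hcon
    exact hx hcon
  -- Forward invariance of `Y` makes these sets decrease. Their intersection consists of the
  -- sequences that stay in `Y` forever, which is what shift invariance requires; `p⁻¹(Y)` alone
  -- need not be shift invariant.
  let Z : ℕ → Set (Cover σ) := fun k => {z | z.1.2 k ∈ Y}
  have hZc : ∀ k, IsClosed (Z k) := fun k => isClosed_closure.preimage (continuous_coverPoint k)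
  have hZanti : ∀ k, Z (k + 1) ⊆ Z k := fun k z hz => by
    change z.1.2 k ∈ Y
    rw [← z.2 k]
    exact hYσ _ _ hz
  have hZne : ∀ k, (Z k).Nonempty := by
    intro k
    induction k with
    | zero =>
      obtain ⟨z, hz⟩ := coverProj_surjective hσ x
      exact ⟨z, by change coverProj σ z ∈ Y; rwa [hz]⟩
    | succ k ih =>
      obtain ⟨z, hz⟩ := ih
      -- Prepending a letter moves the point `x_k` to position `k + 1`.
      exact ⟨coverMap σ (firstIndex z) z, hz⟩
  refine ⟨⋂ k, Z k, ?_, ?_, ?_, ?_⟩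
  · exact IsCompact.nonempty_iInter_of_sequence_nonempty_isCompact_isClosed Z hZanti hZne
      (hZc 0).isCompact hZc
  · intro i z hz
    refine Set.mem_iInter.mpr fun k => ?_
    cases k with
    | zero => exact hYσ i _ (Set.mem_iInter.mp hz 0)
    | succ k => exact Set.mem_iInter.mp hz k
  · exact fun z hz => Set.mem_iInter.mpr fun k => Set.mem_iInter.mp hz (k + 1)
  · obtain ⟨f, hf0, hf1, -⟩ := exists_continuous_zero_one_of_isClosed
      (isClosed_closure (s := orbit σ x)) (isClosed_singleton (x := x')) (by simpa using hx')
    refine ⟨((⟨Complex.ofReal, Complex.continuous_ofReal⟩ : C(ℝ, ℂ)).comp f).comp (coverProj σ),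
      fun z hz => ?_, fun e => ?_⟩
    · change (f (coverProj σ z) : ℂ) = 0
      have h1 : coverProj σ z ∈ Y := Set.mem_iInter.mp hz 0
      rw [hf0 h1]
      rfl
    · obtain ⟨z, hz⟩ := coverProj_surjective hσ x'
      have h1 := congrArg (fun F : C(Cover σ, ℂ) => F z) e
      change (f (coverProj σ z) : ℂ) = 0 at h1
      rw [hz, hf1 rfl] at h1
      simp at h1

end InvariantSets

/-! ### Bi-invariant ideals from invariant sets. -/

section InducedIdeals

variable {X : Type u} [TopologicalSpace X] [CompactSpace X] [T2Space X] {n : ℕ}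
  {σ : Fin n → C(X, X)} {E : Type u} [CStarAlgebra E]
  {t : Fin n → E} {π : C(Cover σ, ℂ) →⋆ₐ[ℂ] E}

namespace IsCuntzPair

variable (h : IsCuntzPair t π)
include h

/-- When one inner word is a prefix of the other, the remainder `w` is moved past a function and
replaces it by its composition with `σ̃_w`. This is why `isIdealOf_vanishing` needs only stability
of `Z` under the maps `σ̃ᵢ`. -/
theorem coreGen_mul_coreGen {𝓘₁ 𝓘₂ 𝓘 : Set C(Cover σ, ℂ)}
    (h1 : ∀ f ∈ 𝓘₁, ∀ g ∈ 𝓘₂, ∀ w, f.comp (coverWord σ w) * g ∈ 𝓘)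
    (h2 : ∀ f ∈ 𝓘₁, ∀ g ∈ 𝓘₂, ∀ w, f * g.comp (coverWord σ w) ∈ 𝓘) :
    ∀ a ∈ coreGen t π 𝓘₁, ∀ b ∈ coreGen t π 𝓘₂, a * b ∈ coreOf t π 𝓘 := by
  rintro _ ⟨u, v, f, hf, huv, rfl⟩ _ ⟨x, y, g, hg, hxy, rfl⟩
  have e : wordProd t u * π f * star (wordProd t v) * (wordProd t x * π g * star (wordProd t y)) =
      wordProd t u * π f * (star (wordProd t v) * wordProd t x) * π g * star (wordProd t y) := by
    simp only [mul_assoc]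
  rw [e]
  rcases h.star_word_mul_word v x with ⟨x', rfl, hx⟩ | ⟨v', rfl, hv⟩ | h0
  · have := mem_coreOf (t := t) (π := π) (u := u ++ x') (v := y) (by simp_all) (h1 f hf g hg x')
    rw [wordProd_append, map_mul] at this
    rw [hx, mul_assoc (wordProd t u), h.map_mul_word]
    simpa only [mul_assoc] using this
  · have := mem_coreOf (t := t) (π := π) (u := u) (v := y ++ v') (by simp_all) (h2 f hf g hg v')
    rw [wordProd_append, map_mul, star_mul] at this
    rw [hv, mul_assoc (wordProd t u * π f), h.star_word_mul_map]
    simpa only [mul_assoc] using this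
  · rw [h0]
    simp

theorem isIdealOf_vanishing {Z : Set (Cover σ)} (hZ : ∀ i, ∀ z ∈ Z, coverMap σ i z ∈ Z) :
    IsIdealOf (coreOf t π Set.univ) (coreOf t π (vanishing Z : Set C(Cover σ, ℂ))) where
  le := by
    refine Submodule.topologicalClosure_mono (Submodule.span_mono ?_)
    rintro _ ⟨u, v, g, -, hl, rfl⟩
    exact ⟨u, v, g, trivial, hl, rfl⟩
  closed := isClosed_coreOf _
  mul_left := mul_mem_of_generators (isClosed_coreOf _) (h.coreGen_mul_coreGen
    (fun f _ g hg w z hz => by rw [ContinuousMap.mul_apply, hg z hz, mul_zero])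
    (fun f _ g hg w z hz => by
      rw [ContinuousMap.mul_apply, ContinuousMap.comp_apply, hg _ (coverWord_mem hZ w z hz),
        mul_zero]))
  mul_right b hb x hx := mul_mem_of_generators (isClosed_coreOf _) (h.coreGen_mul_coreGen
    (𝓘₁ := (vanishing Z : Set C(Cover σ, ℂ))) (𝓘₂ := Set.univ)
    (𝓘 := (vanishing Z : Set C(Cover σ, ℂ)))
    (fun f hf g _ w z hz => by
      rw [ContinuousMap.mul_apply, ContinuousMap.comp_apply, hf _ (coverWord_mem hZ w z hz),
        zero_mul])
    (fun f hf g _ w z hz => by rw [ContinuousMap.mul_apply, hf z hz, zero_mul])) x hx b hb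

omit [CompactSpace X] [T2Space X] h in
theorem conj_mem_coreOf {𝓘 : Set C(Cover σ, ℂ)} {J : Submodule ℂ E} (hJ : IsClosed (J : Set E))
    {a c : E} (hac : ∀ b ∈ coreGen t π 𝓘, a * b * c ∈ J) : ∀ b ∈ coreOf t π 𝓘, a * b * c ∈ J := by
  have : coreOf t π 𝓘 ≤ J.comap (LinearMap.mulRight ℂ c ∘ₗ LinearMap.mulLeft ℂ a) :=
    Submodule.topologicalClosure_minimal _ (Submodule.span_le.mpr hac)
      (hJ.preimage ((continuous_mul_const c).comp (continuous_const_mul a)))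
  exact this

omit [CompactSpace X] [T2Space X] h in
theorem avg_conj_mem (𝓘 : Set C(Cover σ, ℂ)) :
    ∀ b ∈ coreOf t π 𝓘, avg t * b * star (avg t) ∈ coreOf t π 𝓘 := by
  refine conj_mem_coreOf (isClosed_coreOf _) ?_
  rintro _ ⟨u, v, g, hg, hl, rfl⟩
  rw [star_avg, avg, smul_mul_assoc, smul_mul_assoc, mul_smul_comm, Finset.sum_mul,
    Finset.sum_mul]
  refine Submodule.smul_mem _ _ (Submodule.smul_mem _ _ (Submodule.sum_mem _ fun i _ => ?_))
  rw [Finset.mul_sum]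
  refine Submodule.sum_mem _ fun k _ => ?_
  have := mem_coreOf (t := t) (π := π) (u := i :: u) (v := k :: v) (by simp [hl]) hg
  simpa only [wordProd_cons, star_mul, mul_assoc] using this

/-- `V^* · V` strips the outermost letters of `t_u g t_v^*`. If the words are empty it averages the
functions `g ∘ σ̃ᵢ`, hence the condition on `𝓘`. -/
theorem star_avg_conj_mem {𝓘 : Set C(Cover σ, ℂ)}
    (h𝓘 : ∀ g ∈ 𝓘, ∀ i, g.comp (coverMap σ i) ∈ 𝓘) :
    ∀ b ∈ coreOf t π 𝓘, star (avg t) * b * avg t ∈ coreOf t π 𝓘 := by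
  refine conj_mem_coreOf (isClosed_coreOf _) ?_
  rintro _ ⟨u, v, g, hg, hl, rfl⟩
  cases u with
  | nil =>
    obtain rfl : v = [] := by simpa using hl.symm
    rw [wordProd_nil, one_mul, star_one, mul_one, avg, mul_smul_comm, Finset.mul_sum]
    refine Submodule.smul_mem _ _ (Submodule.sum_mem _ fun i _ => ?_)
    rw [mul_assoc, h.cov, ← mul_assoc]
    change star (avg t) * _ * _ ∈ _
    rw [h.star_avg_mul, smul_mul_assoc, one_mul]
    exact Submodule.smul_mem _ _ (map_mem_coreOf (h𝓘 g hg i))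
  | cons i u =>
    cases v with
    | nil => simp at hl
    | cons k v =>
      have e : star (avg t) * (wordProd t (i :: u) * π g * star (wordProd t (k :: v))) * avg t =
          star (avg t) * t i * (wordProd t u * π g * star (wordProd t v)) *
            (star (t k) * avg t) := by
        simp only [wordProd_cons, star_mul, mul_assoc]
      rw [e, h.star_avg_mul, h.star_mul_avg, smul_mul_assoc, mul_smul_comm, one_mul, mul_one]
      exact Submodule.smul_mem _ _ (Submodule.smul_mem _ _
        (mem_coreOf (by simpa using hl) hg))

theorem isBiInvariant_vanishing (hn : n ≠ 0) {Z : Set (Cover σ)}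
    (hZ : ∀ i, ∀ z ∈ Z, coverMap σ i z ∈ Z) :
    IsBiInvariant (fun b => avg t * b * star (avg t)) (coreOf t π Set.univ)
      (coreOf t π (vanishing Z : Set C(Cover σ, ℂ))) := by
  refine ⟨avg_conj_mem _, fun b _ hb => ?_⟩
  -- Since `V^* V = 1`, the map `V^* · V` recovers `b` from `α(b)` and preserves the ideal.
  have h1 := h.star_avg_conj_mem (𝓘 := (vanishing Z : Set C(Cover σ, ℂ)))
    (fun g hg i z hz => hg _ (hZ i z hz)) _ hb
  have h2 : star (avg t) * (avg t * b * star (avg t)) * avg t =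
      star (avg t) * avg t * b * (star (avg t) * avg t) := by simp only [mul_assoc]
  rwa [h2, h.star_avg_mul_avg hn, one_mul, mul_one] at h1

/-- An algebraic element within distance less than `1` of the unit would have an eventual diagonal
part vanishing on `Z`, by shift invariance. That function would also be within distance less than
`1` of the constant `1`, which fails at a point of `Z`. -/
theorem one_notMem_coreOf_vanishing (hπ : Function.Injective π) {Z : Set (Cover σ)}
    (hne : Z.Nonempty) (hZ : ∀ z ∈ Z, shift σ z ∈ Z) :
    (1 : E) ∉ coreOf t π (vanishing Z : Set C(Cover σ, ℂ)) := by
  intro h1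
  obtain ⟨y, hy, hdist⟩ := Metric.mem_closure_iff.mp h1 1 one_pos
  rw [dist_eq_norm] at hdist
  obtain ⟨g, hg, L, hL⟩ := h.exists_diagPart_eq (K := vanishing Z)
    (fun u v g hg => diagFun_eq_zero hZ hg u v) hy
  have h2 : ‖(1 : C(Cover σ, ℂ)) - g‖ < 1 := by
    rw [← NonUnitalStarAlgHom.norm_map π hπ, map_sub, ← h.diagPart_map L 1, ← hL L le_rfl,
      ← map_sub, map_one]
    exact (h.norm_diagPart_le L _).trans_lt hdist
  obtain ⟨z, hz⟩ := hne
  have h3 := (1 - g).norm_coe_le_norm z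
  rw [ContinuousMap.sub_apply, hg z hz, sub_zero, ContinuousMap.one_apply, norm_one] at h3
  linarith

/-- If the core has no proper bi-invariant ideals, then the system is minimal. -/
theorem isMinimal_of_biInvariant (hn : n ≠ 0) (hπ : Function.Injective π) (hσ : IsSurjective σ)
    (hJ : ∀ J : Submodule ℂ E, IsIdealOf (coreOf t π Set.univ) J →
      IsBiInvariant (fun b => avg t * b * star (avg t)) (coreOf t π Set.univ) J →
        J = ⊥ ∨ J = coreOf t π Set.univ) : IsMinimal σ := by
  by_contra hmin
  obtain ⟨Z, hne, hZ, hZs, g, hg, hg0⟩ := exists_invariant_set hσ hmin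
  rcases hJ _ (h.isIdealOf_vanishing hZ) (h.isBiInvariant_vanishing hn hZ) with hbot | htop
  · have h1 : π g ∈ coreOf t π (vanishing Z : Set C(Cover σ, ℂ)) := map_mem_coreOf hg
    rw [hbot, Submodule.mem_bot] at h1
    exact hg0 (hπ (h1.trans (map_zero π).symm))
  · refine h.one_notMem_coreOf_vanishing hπ hne hZs ?_
    rw [htop, ← map_one π]
    exact map_mem_coreOf trivial

end IsCuntzPair

end InducedIdeals

end MvDyn

end

theorem corollaryC {X : Type u} [TopologicalSpace X] [CompactSpace X] [T2Space X]
    {n : ℕ} (hn : 2 ≤ n) (σ : Fin n → C(X, X)) (hσ : MvDyn.IsSurjective σ)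
    {E : Type u} [CStarAlgebra E] [PartialOrder E] [StarOrderedRing E]
    (j : MvDyn.CovAlg σ →ₐ[ℂ] E) (hj : MvDyn.IsCStarEnvelope σ j) :
    (∃! π : C(MvDyn.Cover σ, ℂ) →⋆ₐ[ℂ] E, MvDyn.IsCoverExtension σ j π) ∧
    ∀ π : C(MvDyn.Cover σ, ℂ) →⋆ₐ[ℂ] E, MvDyn.IsCoverExtension σ j π →
      List.TFAE [
        MvDyn.IsMinimal σ,
        ∀ J : Submodule ℂ E, MvDyn.IsIdealOf (MvDyn.core σ j π) J →
          MvDyn.IsInvariant (MvDyn.endo σ j) J → J = ⊥ ∨ J = MvDyn.core σ j π,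
        ∀ J : Submodule ℂ E, MvDyn.IsIdealOf (MvDyn.core σ j π) J →
          MvDyn.IsBiInvariant (MvDyn.endo σ j) (MvDyn.core σ j π) J →
            J = ⊥ ∨ J = MvDyn.core σ j π] := by
  obtain ⟨horth, hsum, hex⟩ := hj.relations hσ
  have hpair : ∀ π : C(MvDyn.Cover σ, ℂ) →⋆ₐ[ℂ] E, MvDyn.IsCoverExtension σ j π →
      MvDyn.IsCuntzPair (fun i => j (MvDyn.gen σ i)) π :=
    fun π h => ⟨horth, hsum, h.covariant⟩
  have hn0 : n ≠ 0 := by omega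
  constructor
  · obtain ⟨π, h⟩ := hex
    exact ⟨π, h, fun π' h' => (hpair π' h').unique (hpair π h) fun f =>
      (h'.extend f).trans (h.extend f).symm⟩
  · intro π hext
    have h := hpair π hext
    have hπ : Function.Injective π := h.injective fun f hf =>
      hj.coeff_eq_zero hσ ((hext.extend f).symm.trans hf)
    rw [MvDyn.core_eq_coreOf]
    tfae_have 1 → 2 := fun hmin J hJ hα => h.eq_bot_or_eq_of_isMinimal hJ hn0 hπ hmin hα
    tfae_have 2 → 3 := fun h2 J hJ hα => h2 J hJ hα.1
    tfae_have 3 → 1 := fun h3 => h.isMinimal_of_biInvariant hn0 hπ hσ h3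
    tfae_finish
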